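/- Setting. Let $f=\frac1n\sum_{i=1}^n f_i$ on $\mathbb{R}^d$, where every $f_i$ is convex and differentiable with $L$-Lipschitz gradient ($L>0$), $f$ is $\mu$-strongly convex ($\mu>0$) with minimizer $x^*$, and $\kappa:=L/\mu$. Let $S_i:=\{v:\ [f_i'(x)]_v\neq0 \text{ for some } x\}$ and $\Delta:=\frac1n\max_v|\{i: v\in S_i\}|$; let $D_i$ be the diagonal matrix with entry $n/|\{k:v\in S_k\}|$ at the coordinates $v\in S_i$ and $0$ elsewhere. Asaga with step size $\gamma$ keeps $x\in\mathbb{R}^d$ and $\alpha_1,\dots,\alpha_n\in\mathbb{R}^d$ in a shared memory, with deterministic initial values $x_0$ and $\alpha_i^0$ ($\alpha_i^0$ supported on $S_i$). Each iteration reads all coordinates of $x$ and of all $\alpha_j$, one by one while other iterations may be writing, which gives $\hat x$ and $(\hat\alpha_j)_j$; then it samples $i$ uniformly in $\{1,\dots,n\}$; then, one by one for $v\in S_i$, it atomically adds $-\gamma[f_i'(\hat x)-\hat\alpha_i+D_i\frac1n\sum_k\hat\alpha_k]_v$ to $[x]_v$ and overwrites $[\alpha_i]_v$ by $[f_i'(\hat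 x)]_v$. Iterations are labelled $t=0,1,2,\dots$ in the order in which their reads are completed; $i_t$ is independent of $(i_u)_{u<t}$ and of $(\hat x_u,\hat\alpha^u)_{u\le t}$; and iteration $t$ is finished before iteration $r$ starts whenever $r\ge t+\tau+1$ (the overlap is bounded by $\tau\in\mathbb{N}$). Sequential Sparse Saga is the case $\tau=0$. Put $$a^*(\tau):=\frac{1}{32(1+\tau\sqrt\Delta)\,\xi},\quad \xi:=\sqrt{1+\tfrac1{8\kappa}\min\{\tfrac1{\sqrt\Delta},\tau\}},\quad C_0:=\|x_0-x^*\|^2+\tfrac{1}{5L^2}\sum_{i=1}^n\|\alpha_i^0-f_i'(x^*)\|^2,\quad \rho_{\rm Saga}:=\tfrac15\min\{\tfrac1n,\tfrac1\kappa\}.$$ Statement. (0) Sequential baseline: Sparse Saga with step size $\frac1{5L}$ satisfies $\mathbb{E}\|\hat x_t-x^*\|^2\le(1-\rho_{\rm Saga})^t\,C_0$ for all $t\ge 0$. (1) There is an absolute constant $K>0$ such that for every $C>0$ there is $c>0$, depending only on $C$, with the following property. If $\tau<\frac n{10}$ and $\tau\le\frac{C}{\sqrt\Delta}\max\{1,\frac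 n\kappa\}$, then Asaga with step size $\gamma=a^*(\tau)/L$ satisfies, for all $t\ge0$, $$\mathbb{E}f(\hat x_t)-f(x^*)\le\big(1-c\min\{\tfrac1n,\tfrac1\kappa\}\big)^t\,K\tfrac n\gamma C_0\qquad\text{and}\qquad \mathbb{E}f(\hat x_t)-f(x^*)\le(1-\rho_{\rm Saga})^{ct}\,K\tfrac n\gamma C_0 .$$ That is, its geometric rate factor is $\Omega(\min\{\frac1n,\frac1\kappa\})$, as for Saga, and $t$ asynchronous updates are guaranteed to contract at least as much as the guarantee for $ct$ sequential ones: a linear speedup up to a constant factor. (2) For every $C>0$ there are $a,c,K>0$, depending only on $C$ (in particular not on $\kappa$), such that if $\tau\le\frac{C}{\sqrt\Delta}$, then Asaga with the universal step size $\gamma=\frac aL$ satisfies both bounds of (1). -/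

import Mathlib

open MeasureTheory ProbabilityTheory

noncomputable section

/-- `ℝ^d` with its Euclidean norm. -/
abbrev Vec (d : ℕ) : Type := EuclideanSpace ℝ (Fin d)

/-- A finite sum `f = (1/n) ∑ f_i` on `ℝ^d`, with each `f_i` convex with `L`-Lipschitz gradient and
`f` strongly convex with constant `mu`, its minimizer `xstar`, and the (deterministic) initial
values `x0` of the iterate and `a0` of the table of historical gradients. -/
structure FiniteSumProblem (n d : ℕ) where
  f : Fin n → Vec d → ℝ
  L : ℝ
  mu : ℝ
  xstar : Vec d
  x0 : Vec d
  a0 : Fin n → Vec d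
  n_pos : 0 < n
  L_pos : 0 < L
  mu_pos : 0 < mu
  convex : ∀ i, ConvexOn ℝ Set.univ (f i)
  differentiable : ∀ i, Differentiable ℝ (f i)
  lipschitz_gradient : ∀ i x y, ‖gradient (f i) x - gradient (f i) y‖ ≤ L * ‖x - y‖
  strongConvex : StrongConvexOn Set.univ mu (fun x => (∑ i, f i x) / n)
  xstar_min : ∀ x, (∑ i, f i xstar) / n ≤ (∑ i, f i x) / n
  /-- The initial historical gradient `a0 i` lives on the support of the gradient of `f i`
  (for example, `a0 = 0` or `a0 i = ∇ f_i (x0)`). -/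
  a0_support : ∀ i v, (∀ x, gradient (f i) x v = 0) → a0 i v = 0

namespace FiniteSumProblem

variable {n d : ℕ} (p : FiniteSumProblem n d)

/-- The objective `f = (1/n) ∑ f_i`. -/
def objective (x : Vec d) : ℝ := (∑ i, p.f i x) / n

/-- The condition number `κ = L / μ`. -/
def kappa : ℝ := p.L / p.mu

/-- The support `S_i`: the coordinates at which the gradient of `f_i` can be nonzero. -/
def supp (i : Fin n) : Set (Fin d) := {v | ∃ x, gradient (p.f i) x v ≠ 0}

/-- The number of factors whose support contains the coordinate `v`. -/
def degree (v : Fin d) : ℕ := Set.ncard {i : Fin n | v ∈ p.supp i}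

/-- The sparsity constant `Δ = Δ_r / n`, where `Δ_r = max_v |{i : v ∈ S_i}|`. -/
def Delta : ℝ := ((Finset.univ.sup p.degree : ℕ) : ℝ) / n

open Classical in
/-- `D_i y`: projection onto `S_i` of `y` reweighted by `1 / p_v`, where `p_v` is the
probability that `v ∈ S_i` for a uniformly random `i`. -/
def reweight (i : Fin n) (y : Vec d) : Vec d :=
  WithLp.toLp 2 fun v => if v ∈ p.supp i then y v / ((p.degree v : ℝ) / n) else 0

/-- The Sparse Saga direction `g(x, α, i) = f_i'(x) - α_i + D_i ((1/n) ∑ α_k)`. -/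
def direction (x : Vec d) (α : Fin n → Vec d) (i : Fin n) : Vec d :=
  gradient (p.f i) x - α i + p.reweight i ((n : ℝ)⁻¹ • ∑ k, α k)

/-- `C_0 = ‖x_0 - x*‖² + (1 / (5 L²)) ∑ ‖α_i^0 - f_i'(x*)‖²`. -/
def initialError : ℝ :=
  ‖p.x0 - p.xstar‖ ^ 2 + 1 / (5 * p.L ^ 2) * ∑ i, ‖p.a0 i - gradient (p.f i) p.xstar‖ ^ 2

/-- `ξ(κ, Δ, τ) = √(1 + (1 / (8 κ)) min {1 / √Δ, τ})`. -/
def xi (τ : ℕ) : ℝ :=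
  Real.sqrt (1 + 1 / (8 * p.kappa) * min (1 / Real.sqrt p.Delta) (τ : ℝ))

/-- `a*(τ) = 1 / (32 (1 + τ √Δ) ξ(κ, Δ, τ))`. -/
def aStar (τ : ℕ) : ℝ := 1 / (32 * (1 + τ * Real.sqrt p.Delta) * p.xi τ)

/-- The rate factor `(1/5) min {1/n, 1/κ}` of sequential Sparse Saga at step size `1 / (5 L)`. -/
def sagaRate : ℝ := 1 / 5 * min (1 / (n : ℝ)) (1 / p.kappa)

end FiniteSumProblem

/-- The times at which one iteration of the algorithm accesses the shared memory:
it starts, reads every coordinate of `x` and of all the `α_j` one by one in any order, has completed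
its read (and then samples its index `i`), writes the coordinates `v ∈ S_i` of `x` and of `α_i` one
by one in any order, and finishes. -/
structure IterationTimes (n d : ℕ) where
  start : ℝ
  readX : Fin d → ℝ
  readA : Fin n → Fin d → ℝ
  readEnd : ℝ
  writeX : Fin d → ℝ
  writeA : Fin d → ℝ
  finish : ℝ

/-- The times of one iteration are in the order prescribed by the algorithm, where `S` is the
support of the sampled factor (only these coordinates are written). -/
structure IterationTimes.Ordered {n d : ℕ} (T : IterationTimes n d) (S : Set (Fin d)) : Prop where
  start_le_readX : ∀ v, T.start ≤ T.readX v
  start_le_readA : ∀ j v, T.start ≤ T.readA j v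
  start_le_readEnd : T.start ≤ T.readEnd
  readX_le : ∀ v, T.readX v ≤ T.readEnd
  readA_le : ∀ j v, T.readA j v ≤ T.readEnd
  readEnd_le_writeX : ∀ v ∈ S, T.readEnd ≤ T.writeX v
  readEnd_le_writeA : ∀ v ∈ S, T.readEnd ≤ T.writeA v
  writeX_le_finish : ∀ v ∈ S, T.writeX v ≤ T.finish
  writeA_le_finish : ∀ v ∈ S, T.writeA v ≤ T.finish
  readEnd_le_finish : T.readEnd ≤ T.finish

open Classical in
/-- `xhat`, `ahat` and `idx` are the inconsistent reads of the iterate, the inconsistent reads of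
the table of historical gradients and the sampled indices of an execution of Asaga on `p` with
step size `γ` on a shared memory with lock-free asynchronous iterations, at most `τ` of which
overlap with any given one. The iterations are labelled in the order of their completed reads.
A read of a memory cell at time `s` returns the result of all writes to that cell before `s`.
Since the writes of iteration `u` follow its completed read, iteration `t` can only see writes of
iterations `u < t`. -/
structure IsAsagaRun {n d : ℕ} (p : FiniteSumProblem n d) (γ : ℝ) (τ : ℕ)
    {Ω : Type*} [MeasurableSpace Ω] (P : Measure Ω)
    (idx : ℕ → Ω → Fin n) (xhat : ℕ → Ω → Vec d) (ahat : ℕ → Ω → Fin n → Vec d)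
    (T : ℕ → Ω → IterationTimes n d) : Prop where
  measurable_idx : ∀ t, Measurable (idx t)
  measurable_xhat : ∀ t, Measurable (xhat t)
  measurable_ahat : ∀ t, Measurable (ahat t)
  /-- The index is sampled uniformly ... -/
  uniform : ∀ t j, P {ω | idx t ω = j} = (n : ENNReal)⁻¹
  /-- ... and independently of everything that was sampled before or read up to now. -/
  indep : ∀ t, IndepFun (idx t)
    (fun ω => ((fun u : Fin t => idx u ω), (fun u : Fin (t + 1) => xhat u ω),
      (fun u : Fin (t + 1) => ahat u ω))) P
  ordered : ∀ t ω, (T t ω).Ordered (p.supp (idx t ω))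
  /-- Labels follow the order of completed reads. -/
  readEnd_mono : ∀ ω, Monotone fun t => (T t ω).readEnd
  /-- Bounded overlaps: iteration `t` has finished when iteration `r ≥ t + τ + 1` starts. -/
  overlap : ∀ ω t r, t + τ + 1 ≤ r → (T t ω).finish < (T r ω).start
  /-- Two writes to the same coordinate of the same `α_j` are not simultaneous. -/
  writeA_ne : ∀ ω t u v, t ≠ u → idx t ω = idx u ω → v ∈ p.supp (idx t ω) →
    (T t ω).writeA v ≠ (T u ω).writeA v
  /-- The writes to `x` are atomic additions of `-γ g` on the support of the sampled factor. -/
  xhat_eq : ∀ t ω v, xhat t ω v = p.x0 v + ∑ u ∈ Finset.range t,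
    if v ∈ p.supp (idx u ω) ∧ (T u ω).writeX v < (T t ω).readX v
      then -γ * p.direction (xhat u ω) (ahat u ω) (idx u ω) v else 0
  /-- A coordinate of `α_j` that has not been written yet has its initial value. -/
  ahat_init : ∀ t ω j v,
    (∀ u < t, ¬ (idx u ω = j ∧ v ∈ p.supp j ∧ (T u ω).writeA v < (T t ω).readA j v)) →
      ahat t ω j v = p.a0 j v
  /-- Otherwise it has the value `[f_j'(xhat u)]_v` that was written to it last. -/
  ahat_last : ∀ t ω j v, ∀ u < t,
    idx u ω = j → v ∈ p.supp j → (T u ω).writeA v < (T t ω).readA j v →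
      (∀ w < t, idx w ω = j → (T w ω).writeA v < (T t ω).readA j v →
        (T w ω).writeA v ≤ (T u ω).writeA v) →
      ahat t ω j v = gradient (p.f j) (xhat u ω) v

/-- The reads `xhat t` converge in expected suboptimality geometrically, with rate factor
`c * min {1/n, 1/κ}` and prefactor `K (n/γ) C_0`; and `t` iterations come with at least the
contraction that `c * t` iterations of sequential Sparse Saga are guaranteed to give. -/
def MatchesSagaRate {n d : ℕ} (p : FiniteSumProblem n d) (γ : ℝ) {Ω : Type*} [MeasurableSpace Ω]
    (P : Measure Ω) (xhat : ℕ → Ω → Vec d) (c K : ℝ) : Prop :=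
  ∀ t : ℕ,
    Integrable (fun ω => p.objective (xhat t ω)) P ∧
    (∫ ω, p.objective (xhat t ω) ∂P) - p.objective p.xstar ≤
      (1 - c * min (1 / (n : ℝ)) (1 / p.kappa)) ^ t * (K * (n / γ) * p.initialError) ∧
    (∫ ω, p.objective (xhat t ω) ∂P) - p.objective p.xstar ≤
      (1 - p.sagaRate) ^ (c * (t : ℝ)) * (K * (n / γ) * p.initialError)

end

/-! The analysis follows a virtual iterate `virtual t = x₀ - γ ∑_{u<t} g_u`, in which the updates of
all earlier iterations are complete. Writing x_t for it, x̂_t for the read and g_t for the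
direction, ‖x_{t+1} - x*‖² = ‖x_t - x*‖² - 2γ⟨g_t, x̂_t - x*⟩ + 2γ⟨g_t, x̂_t - x_t⟩ + γ²‖g_t‖². The
index i_t is independent of the reads, and the reweighting D_i makes g_t an unbiased estimate of
f'(x̂_t); strong convexity then turns the first inner product into the suboptimality of x̂_t plus a
multiple of ‖x̂_t - x*‖².

The asynchrony error x̂_t - x_t consists, coordinate by coordinate, of some of the last τ updates
(`abs_xhat_sub_virtual_le`). By sparsity two directions share few coordinates: since i_t is
independent of g_u for u < t, a coordinate of g_u meets S_{i_t} with probability at most Δ, so E ∑_v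
|g_u||g_t| is at most √Δ/2 times the sum of the second moments (`integral_cross_le`). This gives
`distSq_recursion`.

The second moment of g_t is controlled by past suboptimalities. Each coordinate of the table entry
α_j was written by an iteration u not followed by an update of j lying entirely between u and the
read; this has probability (1 - 1/n)^(t-u-1-2τ), whence `memorySq_le` and `dirSq_recursion`.

The two delayed recursions are deterministic. Multiplying by (1-ρ)^(-t) and summing
(`geometric_of_delayed_recursion`), the second moments absorb only half of the available decrease 2γ
∑ e_t, and any single term of the remaining sum satisfies the geometric bound. It remains to choose
ρ and γ. The sequential baseline has its own Lyapunov function, distance plus a multiple of the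
memory error (`sequential_step`).

No measurability of the access times is needed: they enter only through pointwise bounds.
Integrability is automatic because every random quantity takes finitely many values. -/

section Convex

/-! ### First-order inequalities for convex and smooth functions. -/

variable {E : Type*} [NormedAddCommGroup E] [InnerProductSpace ℝ E]

theorem ConvexOn.add_fderiv_le {f : E → ℝ} {f' : E →L[ℝ] ℝ} {x : E}
    (hf : ConvexOn ℝ Set.univ f) (hf' : HasFDerivAt f f' x) (y : E) :
    f x + f' (y - x) ≤ f y := by
  have hline : HasDerivAt (fun t : ℝ => f (AffineMap.lineMap x y t)) (f' (y - x)) 0 := by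
    have h1 : HasDerivAt (fun t : ℝ => (AffineMap.lineMap x y t : E)) (y - x) 0 :=
      AffineMap.hasDerivAt_lineMap
    have h2 : HasFDerivAt f f' (AffineMap.lineMap x y (0 : ℝ)) := by simpa using hf'
    exact h2.comp_hasDerivAt 0 h1
  have hconv : ConvexOn ℝ Set.univ (fun t : ℝ => f (AffineMap.lineMap x y t)) := by
    have := hf.comp_affineMap (AffineMap.lineMap x y : ℝ →ᵃ[ℝ] E)
    simpa [Function.comp_def] using this
  have := hconv.le_slope_of_hasDerivAt (Set.mem_univ 0) (Set.mem_univ 1) one_pos hline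
  simp only [slope_def_field, AffineMap.lineMap_apply_one, AffineMap.lineMap_apply_zero, sub_zero,
    div_one] at this
  linarith

/-- Subtracting m/2 ‖x‖² leaves a convex function, to which the tangent inequality applies. -/
theorem StrongConvexOn.add_fderiv_add_norm_sq_le {f : E → ℝ} {f' : E →L[ℝ] ℝ} {x : E} {m : ℝ}
    (hf : StrongConvexOn Set.univ m f) (hf' : HasFDerivAt f f' x) (y : E) :
    f x + f' (y - x) + m / 2 * ‖y - x‖ ^ 2 ≤ f y := by
  rw [strongConvexOn_iff_convex] at hf
  have hn : HasFDerivAt (fun x : E => m / 2 * ‖x‖ ^ 2) ((m / 2) • (2 • innerSL ℝ x)) x :=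
    (hasStrictFDerivAt_norm_sq x).hasFDerivAt.const_mul (m / 2)
  have h := hf.add_fderiv_le (hf'.sub hn) y
  have e : ‖y - x‖ ^ 2 = ‖y‖ ^ 2 - 2 * inner ℝ x y + ‖x‖ ^ 2 := by
    rw [norm_sub_sq_real, real_inner_comm]
  simp only [sub_apply, smul_apply, innerSL_apply_apply,
    inner_sub_right, real_inner_self_eq_norm_sq, smul_eq_mul, nsmul_eq_mul, Nat.cast_ofNat] at h
  rw [e]
  linarith

variable [CompleteSpace E]

theorem ConvexOn.add_inner_gradient_le {f : E → ℝ} (hf : ConvexOn ℝ Set.univ f)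
    (hd : Differentiable ℝ f) (x y : E) : f x + inner ℝ (gradient f x) (y - x) ≤ f y := by
  have h := hf.add_fderiv_le (hd x).hasFDerivAt y
  rwa [(hd x).hasGradientAt.fderiv_apply] at h

theorem le_add_inner_gradient_of_lipschitz {f : E → ℝ} {L : ℝ} (hd : Differentiable ℝ f)
    (hL : ∀ x y, ‖gradient f x - gradient f y‖ ≤ L * ‖x - y‖) (x y : E) :
    f y ≤ f x + inner ℝ (gradient f x) (y - x) + L / 2 * ‖y - x‖ ^ 2 := by
  set h := y - x with hh
  let ψ : ℝ → ℝ := fun t => f (x + t • h) - t * inner ℝ (gradient f x) h - L / 2 * t ^ 2 * ‖h‖ ^ 2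
  have hder : ∀ t, HasDerivAt ψ (inner ℝ (gradient f (x + t • h)) h - inner ℝ (gradient f x) h
      - L * t * ‖h‖ ^ 2) t := by
    intro t
    have h1 : HasDerivAt (fun t : ℝ => x + t • h) h t := by
      simpa using ((hasDerivAt_id t).smul_const h).const_add x
    have h2 := (hd (x + t • h)).hasFDerivAt.comp_hasDerivAt t h1
    rw [(hd (x + t • h)).hasGradientAt.fderiv_apply] at h2
    have h3 : HasDerivAt (fun t : ℝ => t * inner ℝ (gradient f x) h)
        (inner ℝ (gradient f x) h) t := by
      simpa using (hasDerivAt_id t).mul_const (inner ℝ (gradient f x) h)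
    have h4 : HasDerivAt (fun t : ℝ => L / 2 * t ^ 2 * ‖h‖ ^ 2) (L * t * ‖h‖ ^ 2) t := by
      have := ((hasDerivAt_pow 2 t).const_mul (L / 2)).mul_const (‖h‖ ^ 2)
      refine this.congr_deriv ?_
      push_cast
      ring
    exact (h2.sub h3).sub h4
  have hanti : AntitoneOn ψ (Set.Icc 0 1) := by
    apply antitoneOn_of_deriv_nonpos (convex_Icc 0 1)
    · exact fun t _ => (hder t).continuousAt.continuousWithinAt
    · exact fun t _ => (hder t).differentiableAt.differentiableWithinAt
    · intro t ht
      rw [interior_Icc] at ht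
      rw [(hder t).deriv, ← inner_sub_left]
      have h1 := real_inner_le_norm (gradient f (x + t • h) - gradient f x) h
      have h2 := hL (x + t • h) x
      rw [add_sub_cancel_left, norm_smul, Real.norm_of_nonneg ht.1.le] at h2
      have h3 := mul_le_mul_of_nonneg_right h2 (norm_nonneg h)
      nlinarith
  have := hanti (Set.left_mem_Icc.2 zero_le_one) (Set.right_mem_Icc.2 zero_le_one) zero_le_one
  simp only [ψ, one_smul, zero_smul, hh, add_sub_cancel, add_zero] at this
  simp only [hh]
  nlinarith

/-- Cocoercivity of the gradient of a smooth convex function. -/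
theorem ConvexOn.add_inner_gradient_add_norm_sq_le {f : E → ℝ} {L : ℝ} (hL0 : 0 < L)
    (hf : ConvexOn ℝ Set.univ f) (hd : Differentiable ℝ f)
    (hL : ∀ x y, ‖gradient f x - gradient f y‖ ≤ L * ‖x - y‖) (x y : E) :
    f x + inner ℝ (gradient f x) (y - x) + 1 / (2 * L) * ‖gradient f y - gradient f x‖ ^ 2
      ≤ f y := by
  set D := gradient f y - gradient f x with hD
  -- At the test point y - D/L, convexity at x bounds f from below and smoothness at y bounds it
  -- from above; 1/L is the step that maximizes the gain.
  have h1 := hf.add_inner_gradient_le hd x (y - (1 / L) • D)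
  have h2 := le_add_inner_gradient_of_lipschitz hd hL y (y - (1 / L) • D)
  have e1 : y - (1 / L) • D - x = (y - x) - (1 / L) • D := by abel
  have e2 : y - (1 / L) • D - y = - ((1 / L) • D) := by abel
  rw [e1, inner_sub_right, real_inner_smul_right] at h1
  rw [e2, inner_neg_right, real_inner_smul_right, norm_neg, norm_smul, mul_pow,
    Real.norm_of_nonneg (by positivity)] at h2
  have e3 : inner ℝ (gradient f y) D - inner ℝ (gradient f x) D = ‖D‖ ^ 2 := by
    rw [← inner_sub_left, real_inner_self_eq_norm_sq]
  have e4 : L / 2 * ((1 / L) ^ 2 * ‖D‖ ^ 2) = 1 / (2 * L) * ‖D‖ ^ 2 := by field_simp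
  have e5 : 1 / L * ‖D‖ ^ 2 = 2 * (1 / (2 * L) * ‖D‖ ^ 2) := by field_simp
  rw [e4] at h2
  have e6 : 1 / L * inner ℝ (gradient f y) D - 1 / L * inner ℝ (gradient f x) D
      = 1 / L * ‖D‖ ^ 2 := by rw [← e3]; ring
  linarith

end Convex

/-! ### The finite sum and the mean and second moment of the Sparse Saga direction. -/

namespace FiniteSumProblem

variable {n d : ℕ} (p : FiniteSumProblem n d)

theorem n_cast_pos (p : FiniteSumProblem n d) : (0 : ℝ) < n := Nat.cast_pos.2 p.n_pos

theorem one_le_n_cast (p : FiniteSumProblem n d) : (1 : ℝ) ≤ n := Nat.one_le_cast.2 p.n_pos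

/-- The gradient of the objective. -/
noncomputable def fullGradient (x : Vec d) : Vec d := (n : ℝ)⁻¹ • ∑ i, gradient (p.f i) x

theorem hasFDerivAt_objective (x : Vec d) :
    HasFDerivAt p.objective (innerSL ℝ (p.fullGradient x)) x := by
  have h : HasFDerivAt (fun x => (n : ℝ)⁻¹ * ∑ i, p.f i x)
      ((n : ℝ)⁻¹ • ∑ i, fderiv ℝ (p.f i) x) x :=
    (HasFDerivAt.fun_sum fun i _ => (p.differentiable i x).hasFDerivAt).const_mul _
  have e1 : p.objective = fun x => (n : ℝ)⁻¹ * ∑ i, p.f i x := by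
    funext x; simp [objective, div_eq_inv_mul]
  rw [e1]
  refine h.congr_fderiv (ContinuousLinearMap.ext fun v => ?_)
  simp only [fullGradient, innerSL_apply_apply, real_inner_smul_left, sum_inner, smul_apply,
    sum_apply, smul_eq_mul]
  congr 1
  exact Finset.sum_congr rfl fun i _ => (p.differentiable i x).hasGradientAt.fderiv_apply

theorem objective_xstar_le (x : Vec d) : p.objective p.xstar ≤ p.objective x := p.xstar_min x

theorem fullGradient_xstar : p.fullGradient p.xstar = 0 := by
  have h := IsLocalMin.hasFDerivAt_eq_zero
    (Filter.Eventually.of_forall p.objective_xstar_le) (p.hasFDerivAt_objective p.xstar)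
  have h2 := DFunLike.congr_fun h (p.fullGradient p.xstar)
  simpa [innerSL_apply_apply] using h2

theorem sum_gradient_xstar : ∑ i, gradient (p.f i) p.xstar = 0 := by
  have h := p.fullGradient_xstar
  have hn := p.n_cast_pos.ne'
  simpa [fullGradient, hn, p.n_pos.ne'] using h

theorem objective_add_norm_sq_le_inner (x : Vec d) :
    p.objective x - p.objective p.xstar + p.mu / 2 * ‖x - p.xstar‖ ^ 2
      ≤ inner ℝ (p.fullGradient x) (x - p.xstar) := by
  have h := StrongConvexOn.add_fderiv_add_norm_sq_le (f := p.objective) p.strongConvex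
    (p.hasFDerivAt_objective x) p.xstar
  rw [innerSL_apply_apply, ← neg_sub x, inner_neg_right, norm_neg] at h
  linarith

/-- Cocoercivity of each f_i at x*; the linear terms cancel in the sum because the gradients at x*
add up to zero. -/
theorem sum_norm_sq_gradient_sub_le (x : Vec d) :
    ∑ i, ‖gradient (p.f i) x - gradient (p.f i) p.xstar‖ ^ 2
      ≤ 2 * p.L * n * (p.objective x - p.objective p.xstar) := by
  have h : ∀ i, 1 / (2 * p.L) * ‖gradient (p.f i) x - gradient (p.f i) p.xstar‖ ^ 2 ≤
      p.f i x - p.f i p.xstar - inner ℝ (gradient (p.f i) p.xstar) (x - p.xstar) := by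
    intro i
    have := (p.convex i).add_inner_gradient_add_norm_sq_le p.L_pos (p.differentiable i)
      (p.lipschitz_gradient i) p.xstar x
    linarith
  have hs := Finset.sum_le_sum fun i (_ : i ∈ Finset.univ) => h i
  rw [← Finset.mul_sum, Finset.sum_sub_distrib, Finset.sum_sub_distrib, ← sum_inner,
    p.sum_gradient_xstar, inner_zero_left, sub_zero] at hs
  have hn := p.n_cast_pos
  have e : (n : ℝ) * (p.objective x - p.objective p.xstar)
      = ∑ i, p.f i x - ∑ i, p.f i p.xstar := by
    simp only [objective]; field_simp
  have hL := p.L_pos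
  rw [mul_assoc, e]
  rw [one_div, inv_mul_le_iff₀ (by positivity)] at hs
  exact hs

theorem continuous_gradient (i : Fin n) : Continuous (gradient (p.f i)) := by
  have : LipschitzWith p.L.toNNReal (gradient (p.f i)) :=
    LipschitzWith.of_dist_le_mul fun x y => by
      rw [dist_eq_norm, dist_eq_norm, Real.coe_toNNReal _ p.L_pos.le]
      exact p.lipschitz_gradient i x y
  exact this.continuous

theorem continuous_objective : Continuous p.objective :=
  continuous_iff_continuousAt.2 fun x => (p.hasFDerivAt_objective x).continuousAt

/-- A table of historical gradients whose entry `i` lives on the support `S_i`. -/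
def IsSupported (α : Fin n → Vec d) : Prop := ∀ i v, v ∉ p.supp i → α i v = 0

variable {p}

theorem gradient_apply_eq_zero {i : Fin n} {v : Fin d} (hv : v ∉ p.supp i) (x : Vec d) :
    gradient (p.f i) x v = 0 := by
  by_contra h
  exact hv ⟨x, h⟩

theorem isSupported_a0 : p.IsSupported p.a0 := fun i v hv =>
  p.a0_support i v fun x => gradient_apply_eq_zero hv x

theorem reweight_apply_of_notMem {i : Fin n} {v : Fin d} (hv : v ∉ p.supp i) (y : Vec d) :
    p.reweight i y v = 0 := by
  simp [reweight, hv]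

theorem reweight_apply_of_mem {i : Fin n} {v : Fin d} (hv : v ∈ p.supp i) (y : Vec d) :
    p.reweight i y v = y v / ((p.degree v : ℝ) / n) := by
  simp [reweight, hv]

theorem direction_apply_eq_zero {α : Fin n → Vec d} (hα : p.IsSupported α) {i : Fin n} {v : Fin d}
    (hv : v ∉ p.supp i) (x : Vec d) : p.direction x α i v = 0 := by
  simp [direction, gradient_apply_eq_zero hv, hα i v hv, reweight_apply_of_notMem hv]

open Classical in
theorem degree_eq_card (v : Fin d) :
    p.degree v = (Finset.univ.filter fun i => v ∈ p.supp i).card := by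
  rw [degree, ← Set.ncard_coe_finset]
  congr 1
  ext i; simp

open Classical in
theorem sum_ite_mem_supp (v : Fin d) (c : ℝ) :
    ∑ i, (if v ∈ p.supp i then c else 0) = p.degree v * c := by
  rw [← Finset.sum_filter, Finset.sum_const, ← degree_eq_card, nsmul_eq_mul]

theorem sum_apply_eq_zero_of_degree {α : Fin n → Vec d} (hα : p.IsSupported α) {v : Fin d}
    (hv : p.degree v = 0) : ∑ i, α i v = 0 := by
  classical
  rw [degree_eq_card, Finset.card_eq_zero, Finset.filter_eq_empty_iff] at hv
  exact Finset.sum_eq_zero fun i _ => hα i v (hv (Finset.mem_univ i))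

theorem reweight_apply (i : Fin n) (y : Vec d) (v : Fin d) [Decidable (v ∈ p.supp i)] :
    p.reweight i y v = if v ∈ p.supp i then y v / ((p.degree v : ℝ) / n) else 0 := by
  split_ifs with h
  · exact reweight_apply_of_mem h y
  · exact reweight_apply_of_notMem h y

/-- Unbiasedness of the reweighting: the coordinate v is kept by `degree v` of the n factors, each
time divided by `degree v / n`. -/
theorem sum_reweight_average {α : Fin n → Vec d} (hα : p.IsSupported α) :
    ∑ i, p.reweight i ((n : ℝ)⁻¹ • ∑ k, α k) = ∑ k, α k := by
  classical
  ext v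
  simp only [WithLp.ofLp_sum, Finset.sum_apply, reweight_apply, sum_ite_mem_supp, WithLp.ofLp_smul,
    Pi.smul_apply, smul_eq_mul]
  have hn := p.n_cast_pos
  -- If no factor touches v, the division by zero is harmless, since the table vanishes there as
  -- well.
  rcases eq_or_ne (p.degree v) 0 with h | h
  · rw [h, sum_apply_eq_zero_of_degree hα h]; simp
  · field_simp

theorem sum_direction {α : Fin n → Vec d} (hα : p.IsSupported α) (x : Vec d) :
    ∑ i, p.direction x α i = ∑ i, gradient (p.f i) x := by
  simp only [direction, Finset.sum_add_distrib, Finset.sum_sub_distrib, sum_reweight_average hα]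
  abel

/-- In each coordinate v the reweighted average is the mean `s` of β_i over the factors that touch
v, and centering at the mean does not increase a sum of squares. -/
theorem sum_norm_sq_sub_reweight_le {α β : Fin n → Vec d} (hβ : p.IsSupported β)
    (hsum : ∑ i, β i = ∑ i, α i) :
    ∑ i, ‖β i - p.reweight i ((n : ℝ)⁻¹ • ∑ k, α k)‖ ^ 2 ≤ ∑ i, ‖β i‖ ^ 2 := by
  classical
  simp only [EuclideanSpace.real_norm_sq_eq]
  rw [Finset.sum_comm, Finset.sum_comm (f := fun i v => β i v ^ 2)]
  refine Finset.sum_le_sum fun v _ => ?_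
  rw [← hsum]
  set y := (n : ℝ)⁻¹ • ∑ k, β k with hy
  have hyv : y v = (n : ℝ)⁻¹ * ∑ i, β i v := by simp [hy]
  have hn := p.n_cast_pos
  set s := y v / ((p.degree v : ℝ) / n) with hs
  have e : ∀ i, (β i - p.reweight i y) v ^ 2
      = β i v ^ 2 - 2 * s * β i v + if v ∈ p.supp i then s ^ 2 else 0 := by
    intro i
    simp only [WithLp.ofLp_sub, Pi.sub_apply, reweight_apply]
    split_ifs with h
    · ring
    · rw [hβ i v h]; ring
  simp only [e, Finset.sum_add_distrib, Finset.sum_sub_distrib, ← Finset.mul_sum, sum_ite_mem_supp]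
  rcases eq_or_ne (p.degree v) 0 with h | h
  · rw [h, sum_apply_eq_zero_of_degree hβ h]; simp
  · have hd : (0 : ℝ) < p.degree v := by positivity
    have hS : ∑ i, β i v = p.degree v * s := by
      rw [hs, hyv]; field_simp
    rw [hS]
    nlinarith [mul_nonneg hd.le (sq_nonneg s)]

/-- The direction is (f_i'(x) - f_i'(x*)) minus the centered table error; centering applies because
the gradients at x* have zero sum, so the table and its error have the same average. -/
theorem sum_norm_sq_direction_le {α : Fin n → Vec d} (hα : p.IsSupported α) (x : Vec d) :
    ∑ i, ‖p.direction x α i‖ ^ 2 ≤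
      2 * ∑ i, ‖gradient (p.f i) x - gradient (p.f i) p.xstar‖ ^ 2
        + 2 * ∑ i, ‖α i - gradient (p.f i) p.xstar‖ ^ 2 := by
  have hβ : p.IsSupported fun i => α i - gradient (p.f i) p.xstar := fun i v hv => by
    simp [hα i v hv, gradient_apply_eq_zero hv]
  have hsum : ∑ i, (α i - gradient (p.f i) p.xstar) = ∑ i, α i := by
    rw [Finset.sum_sub_distrib, p.sum_gradient_xstar, sub_zero]
  have h := sum_norm_sq_sub_reweight_le hβ hsum
  have h2 : ∀ i, ‖p.direction x α i‖ ^ 2 ≤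
      2 * ‖gradient (p.f i) x - gradient (p.f i) p.xstar‖ ^ 2 +
      2 * ‖α i - gradient (p.f i) p.xstar - p.reweight i ((n : ℝ)⁻¹ • ∑ k, α k)‖ ^ 2 := by
    intro i
    set a := gradient (p.f i) x - gradient (p.f i) p.xstar with ha
    set b := α i - gradient (p.f i) p.xstar - p.reweight i ((n : ℝ)⁻¹ • ∑ k, α k) with hb
    have e : p.direction x α i = a - b := by simp only [direction, ha, hb]; abel
    rw [e]
    nlinarith [parallelogram_law_with_norm ℝ a b, sq_nonneg ‖a + b‖]
  refine (Finset.sum_le_sum fun i _ => h2 i).trans ?_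
  rw [Finset.sum_add_distrib, ← Finset.mul_sum, ← Finset.mul_sum]
  linarith

variable (p)

theorem Delta_nonneg : 0 ≤ p.Delta := by unfold Delta; positivity

theorem degree_div_le_Delta (v : Fin d) : (p.degree v : ℝ) / n ≤ p.Delta := by
  unfold Delta
  gcongr
  exact Finset.le_sup (Finset.mem_univ v)

theorem one_div_le_Delta (h : p.Delta ≠ 0) : 1 / (n : ℝ) ≤ p.Delta := by
  unfold Delta at h ⊢
  gcongr
  rw [Nat.one_le_cast, Nat.one_le_iff_ne_zero]
  rintro h0
  simp [h0] at h

theorem kappa_pos : 0 < p.kappa := div_pos p.L_pos p.mu_pos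

theorem initialError_nonneg : 0 ≤ p.initialError := by
  have := p.L_pos
  unfold initialError
  positivity

end FiniteSumProblem

/-! ### Deterministic analysis of the delayed recursions. -/

section Sequences

open Finset

/-- Young's inequality for a causal convolution: exchange the sums and bound the kernel by its total
mass. -/
theorem sum_convolution_le {K a : ℕ → ℝ} {B : ℝ} (ha : ∀ u, 0 ≤ a u)
    (hB : ∀ M, ∑ k ∈ range M, K k ≤ B) (N : ℕ) :
    ∑ t ∈ range N, ∑ u ∈ range t, K (t - u - 1) * a u ≤ B * ∑ u ∈ range N, a u := by
  have h : ∑ t ∈ range N, ∑ u ∈ range t, K (t - u - 1) * a u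
      = ∑ u ∈ range N, ∑ t ∈ Ico (u + 1) N, K (t - u - 1) * a u := by
    refine sum_comm' fun t u => ?_
    simp only [mem_range, mem_Ico]
    omega
  rw [h, mul_sum]
  refine sum_le_sum fun u _ => ?_
  rw [← sum_mul, sum_Ico_eq_sum_range]
  refine mul_le_mul_of_nonneg_right ?_ (ha u)
  refine le_trans (le_of_eq (sum_congr rfl fun k _ => ?_)) (hB (N - (u + 1)))
  congr 1
  omega

/-- Truncated subtraction makes the first s terms equal to 1; a geometric series follows. -/
theorem sum_range_pow_tsub_le {r : ℝ} (h0 : 0 ≤ r) (h1 : r < 1) (s M : ℕ) :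
    ∑ k ∈ range M, r ^ (k - s) ≤ s + 1 / (1 - r) := by
  calc ∑ k ∈ range M, r ^ (k - s) ≤ ∑ k ∈ range (s + M), r ^ (k - s) :=
        sum_le_sum_of_subset_of_nonneg (range_mono (by omega)) fun _ _ _ => by positivity
    _ = ∑ k ∈ range s, r ^ (k - s) + ∑ k ∈ range M, r ^ k := by
        rw [sum_range_add]
        simp
    _ ≤ s + 1 / (1 - r) := by
        refine add_le_add (le_of_eq ?_) ?_
        · rw [sum_congr rfl (g := fun _ => (1 : ℝ))]
          · simp
          · intro k hk
            rw [Nat.sub_eq_zero_of_le (mem_range.1 hk).le, pow_zero]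
        · rw [geom_sum_eq h1.ne, ← neg_div_neg_eq]
          have : 0 < 1 - r := by linarith
          rw [neg_sub, neg_sub]
          gcongr
          linarith [pow_nonneg h0 M]

/-- For the kernels with delay s: the growing weight costs at most `q ^ s` during the delay and is
compensated by the decay afterwards. -/
theorem pow_mul_pow_tsub_le {q β : ℝ} (hq : 1 ≤ q) (hβ : 0 ≤ β) (k s : ℕ) :
    q ^ k * β ^ (k - s) ≤ q ^ s * (q * β) ^ (k - s) := by
  rw [mul_pow, ← mul_assoc, ← pow_add]
  gcongr
  omega

theorem inv_pow_le_of_mul_le {ρ ε : ℝ} (hρ1 : ρ < 1) {s : ℕ} (hε : ε < 1)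
    (h : s * ρ ≤ ε) : ((1 - ρ)⁻¹) ^ s ≤ (1 - ε)⁻¹ := by
  rw [inv_pow]
  have h1 : 1 + (s : ℝ) * (-ρ) ≤ (1 + -ρ) ^ s := one_add_mul_le_pow (by linarith) s
  have h2 : 1 - ε ≤ (1 - ρ) ^ s := by
    have : 1 + -ρ = 1 - ρ := by ring
    rw [this] at h1
    linarith
  exact inv_anti₀ (by linarith) h2

set_option maxHeartbeats 800000 in
/-- The delayed recursions satisfied by the expected suboptimality `e`, the expected squared
distance `A` of the virtual iterates and the expected squared norm `G` of the directions imply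
geometric convergence of `e`. -/
theorem geometric_of_delayed_recursion {e A G : ℕ → ℝ} {n τ : ℕ} {γ ρ L δ h0 : ℝ}
    (hn : 0 < n) (hγ : 0 < γ) (hρ : 0 ≤ ρ) (hL : 0 < L) (hδ : 0 ≤ δ) (hh0 : 0 ≤ h0)
    (he : ∀ t, 0 ≤ e t) (hA : ∀ t, 0 ≤ A t) (hG : ∀ t, 0 ≤ G t)
    (hτρ : (2 * τ + 1) * ρ ≤ 1 / 10) (hnρ : n * ρ ≤ 1 / 10)
    (hstep : 81 * (γ * L * (1 + τ * δ) * (1 + τ / n)) ≤ 4)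
    (hrec : ∀ t, A (t + 1) ≤ (1 - ρ) * A t + γ ^ 2 * (1 + τ * δ) * G t
      + γ ^ 2 * (δ + 2 * ρ * (1 + τ * δ)) * (∑ u ∈ range t, if t ≤ u + τ then G u else 0)
      - 2 * γ * e t)
    (hmem : ∀ t, G t ≤ 4 * L * e t
      + 4 * L / n * ∑ u ∈ range t, (1 - 1 / (n : ℝ)) ^ (t - u - 1 - 2 * τ) * e u
      + 2 * (1 - 1 / (n : ℝ)) ^ (t - τ) * h0) (t : ℕ) :
    γ * e t ≤ (1 - ρ) ^ t * (A 0 + 1 / (5 * L ^ 2) * (n * h0)) := by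
  have hn' : (0 : ℝ) < n := Nat.cast_pos.2 hn
  have hn1 : (1 : ℝ) ≤ n := Nat.one_le_cast.2 hn
  have hτ0 : (0 : ℝ) ≤ τ := τ.cast_nonneg
  have hτρ' : τ * ρ ≤ 1 / 20 := by nlinarith
  have hρ1 : ρ ≤ 1 / 10 := by nlinarith
  -- Weighting time t by `q ^ t` undoes the contraction, so that the distance recursion telescopes.
  set q : ℝ := (1 - ρ)⁻¹ with hq
  have hρpos : 0 < 1 - ρ := by linarith
  have hq0 : 0 < q := inv_pos.2 hρpos
  have hq1 : 1 ≤ q := (one_le_inv₀ hρpos).2 (by linarith)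
  have hqρ : q * (1 - ρ) = 1 := inv_mul_cancel₀ hρpos.ne'
  have hq2 : q ^ (2 * τ + 1) ≤ 10 / 9 := by
    have := inv_pow_le_of_mul_le (ρ := ρ) (ε := 1 / 10) (s := 2 * τ + 1) (by linarith)
      (by norm_num) (by push_cast; exact hτρ)
    refine this.trans (by norm_num)
  have hqτ : q ^ τ ≤ 10 / 9 := (pow_le_pow_right₀ hq1 (by omega)).trans hq2
  set β : ℝ := 1 - 1 / (n : ℝ) with hβ
  have hn_inv : 1 / (n : ℝ) ≤ 1 := by rw [div_le_one hn']; exact hn1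
  have hβ0 : 0 ≤ β := by rw [hβ]; linarith
  have hr0 : 0 ≤ q * β := by positivity
  -- As ρ ≤ 1/(10n), the forgetting rate 1/n of the table survives the weights up to the factor
  -- 9/10.
  have hr : q * β ≤ 1 - 9 / 10 * (1 / n) := by
    have h1 : ρ ≤ 1 / 10 * (1 / (n : ℝ)) := by
      rw [mul_one_div, le_div_iff₀ hn']; linarith
    have h2 : β ≤ (1 - 9 / 10 * (1 / (n : ℝ))) * (1 - ρ) := by
      rw [hβ]
      have : 0 ≤ 1 / (n : ℝ) := by positivity
      nlinarith
    calc q * β ≤ q * ((1 - 9 / 10 * (1 / (n : ℝ))) * (1 - ρ)) := by gcongr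
      _ = (q * (1 - ρ)) * (1 - 9 / 10 * (1 / (n : ℝ))) := by ring
      _ = _ := by rw [hqρ, one_mul]
  have hpos1 : 0 < 9 / 10 * (1 / (n : ℝ)) := by positivity
  have hr1 : q * β < 1 := by linarith
  have hr2 : 1 / (1 - q * β) ≤ 10 / 9 * n := by
    calc 1 / (1 - q * β) ≤ 1 / (9 / 10 * (1 / (n : ℝ))) := by gcongr; linarith
      _ = 10 / 9 * n := by field_simp
  -- weighted sums
  have hGq : ∀ u, 0 ≤ q ^ u * G u := fun u => mul_nonneg (by positivity) (hG u)
  have heq : ∀ u, 0 ≤ q ^ u * e u := fun u => mul_nonneg (by positivity) (he u)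
  -- The weight is `q ^ (k + 1)` because k stands for t - u - 1, so `q ^ t` is `q ^ (k + 1) * q ^
  -- u`.
  have hkernel : ∀ M, ∑ k ∈ range M, q ^ (k + 1) * β ^ (k - 2 * τ)
      ≤ 10 / 9 * (2 * τ + 10 / 9 * n) := by
    intro M
    calc ∑ k ∈ range M, q ^ (k + 1) * β ^ (k - 2 * τ)
        ≤ ∑ k ∈ range M, q ^ (2 * τ + 1) * (q * β) ^ (k - 2 * τ) := by
          refine sum_le_sum fun k _ => ?_
          rw [pow_succ, pow_succ, mul_right_comm, mul_right_comm (q ^ (2 * τ))]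
          exact mul_le_mul_of_nonneg_right (pow_mul_pow_tsub_le hq1 hβ0 _ _) hq0.le
      _ = q ^ (2 * τ + 1) * ∑ k ∈ range M, (q * β) ^ (k - 2 * τ) := by rw [mul_sum]
      _ ≤ 10 / 9 * (((2 * τ : ℕ) : ℝ) + 1 / (1 - q * β)) := by
          gcongr
          exact sum_range_pow_tsub_le hr0 hr1 _ _
      _ ≤ _ := by push_cast; gcongr
  have hinit : ∀ M, ∑ k ∈ range M, q ^ k * β ^ (k - τ) ≤ 10 / 9 * (τ + 10 / 9 * n) := by
    intro M
    calc ∑ k ∈ range M, q ^ k * β ^ (k - τ)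
        ≤ ∑ k ∈ range M, q ^ τ * (q * β) ^ (k - τ) :=
          sum_le_sum fun k _ => pow_mul_pow_tsub_le hq1 hβ0 _ _
      _ = q ^ τ * ∑ k ∈ range M, (q * β) ^ (k - τ) := by rw [mul_sum]
      _ ≤ 10 / 9 * (τ + 1 / (1 - q * β)) := by
          gcongr
          exact sum_range_pow_tsub_le hr0 hr1 _ _
      _ ≤ _ := by gcongr
  have hwindow : ∀ M, ∑ k ∈ range M, (if k < τ then q ^ (k + 1) else 0) ≤ 10 / 9 * τ := by
    intro M
    calc ∑ k ∈ range M, (if k < τ then q ^ (k + 1) else 0)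
        ≤ ∑ k ∈ range (τ + M), (if k < τ then q ^ (k + 1) else 0) := by
          refine sum_le_sum_of_subset_of_nonneg (range_mono (by omega)) fun _ _ _ => ?_
          split_ifs <;> positivity
      _ = ∑ k ∈ range τ, (if k < τ then q ^ (k + 1) else 0) := by
          rw [sum_range_add]; simp
      _ ≤ ∑ k ∈ range τ, 10 / 9 := by
          refine sum_le_sum fun k hk => ?_
          rw [if_pos (mem_range.1 hk)]
          exact (pow_le_pow_right₀ hq1 (by have := mem_range.1 hk; omega)).trans hqτ
      _ = 10 / 9 * τ := by simp [mul_comm]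
  set S : ℕ → ℝ := fun N => ∑ t ∈ range N, q ^ t * e t with hS
  set Γ : ℕ → ℝ := fun N => ∑ t ∈ range N, q ^ t * G t with hΓ
  have hS0 : ∀ N, 0 ≤ S N := fun N => sum_nonneg fun u _ => heq u
  have hΓ0 : ∀ N, 0 ≤ Γ N := fun N => sum_nonneg fun u _ => hGq u
  have hpow : ∀ {t u : ℕ}, u < t → q ^ t = q ^ (t - u - 1 + 1) * q ^ u := by
    intro t u h
    rw [← pow_add]; congr 1; omega
  have hwin : ∀ N, ∑ t ∈ range N, q ^ t * (∑ u ∈ range t, if t ≤ u + τ then G u else 0)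
      ≤ 10 / 9 * τ * Γ N := by
    intro N
    refine le_trans (le_of_eq ?_) (sum_convolution_le hGq hwindow N)
    refine sum_congr rfl fun t _ => ?_
    rw [mul_sum]
    refine sum_congr rfl fun u hu => ?_
    have hut := mem_range.1 hu
    by_cases h : t ≤ u + τ
    · rw [if_pos h, if_pos (by omega), hpow hut, mul_assoc]
    · rw [if_neg h, if_neg (by omega)]; ring
  have hconv : ∀ N, ∑ t ∈ range N, q ^ t * (∑ u ∈ range t, β ^ (t - u - 1 - 2 * τ) * e u)
      ≤ 10 / 9 * (2 * τ + 10 / 9 * n) * S N := by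
    intro N
    refine le_trans (le_of_eq ?_) (sum_convolution_le heq hkernel N)
    refine sum_congr rfl fun t _ => ?_
    rw [mul_sum]
    refine sum_congr rfl fun u hu => ?_
    rw [hpow (mem_range.1 hu)]
    ring
  -- The constants: 4 + 4·(10/9)² < 9 and 80/9 < 9 for `S N`; 2·(10/9)² < 5/2 and 20/9 < 5/2 for
  -- `h0`.
  have hΓS : ∀ N, Γ N ≤ 9 * L * (1 + τ / n) * S N + 5 / 2 * (n * (1 + τ / n)) * h0 := by
    intro N
    have h1 : Γ N ≤ 4 * L * S N
        + 4 * L / n * ∑ t ∈ range N, q ^ t * (∑ u ∈ range t, β ^ (t - u - 1 - 2 * τ) * e u)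
        + 2 * h0 * ∑ t ∈ range N, q ^ t * β ^ (t - τ) := by
      simp only [hΓ, hS]
      rw [mul_sum, mul_sum, mul_sum, ← sum_add_distrib, ← sum_add_distrib]
      refine sum_le_sum fun t _ => ?_
      have := mul_le_mul_of_nonneg_left (hmem t) (pow_nonneg hq0.le t)
      refine this.trans (le_of_eq ?_)
      ring
    have h2 := mul_le_mul_of_nonneg_left (hconv N) (by positivity : 0 ≤ 4 * L / n)
    have h3 := mul_le_mul_of_nonneg_left (hinit N) (by positivity : 0 ≤ 2 * h0)
    have e2 : 4 * L / n * (10 / 9 * (2 * τ + 10 / 9 * n) * S N)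
        = 4 * L * S N * (10 / 9 * (2 * (τ / n) + 10 / 9)) := by field_simp
    have e3 : (n : ℝ) * (1 + τ / n) = n + τ := by field_simp
    rw [e2] at h2
    rw [e3]
    have h4 : 0 ≤ L * S N := mul_nonneg hL.le (hS0 N)
    have h5 : 0 ≤ L * S N * (τ / n) := mul_nonneg h4 (by positivity)
    have h6 : 0 ≤ h0 * n := by positivity
    have h7 : 0 ≤ h0 * τ := by positivity
    linarith
  set C := 1 + τ * δ with hC
  have hC1 : 1 ≤ C := by rw [hC]; nlinarith [mul_nonneg hτ0 hδ]
  have htel : ∀ N, q ^ N * A N + 2 * γ * q * S N ≤ A 0 + q * (γ ^ 2 * C * Γ N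
      + γ ^ 2 * (δ + 2 * ρ * C)
        * ∑ t ∈ range N, q ^ t * (∑ u ∈ range t, if t ≤ u + τ then G u else 0)) := by
    intro N
    induction N with
    | zero => simp [hS, hΓ]
    | succ N ih =>
      simp only [hS, hΓ] at ih ⊢
      rw [sum_range_succ, sum_range_succ, sum_range_succ _ N]
      have h1 := mul_le_mul_of_nonneg_left (hrec N) (pow_nonneg hq0.le (N + 1))
      have h2 : q ^ (N + 1) * ((1 - ρ) * A N) = q ^ N * A N := by
        rw [pow_succ]
        calc q ^ N * q * ((1 - ρ) * A N) = q ^ N * (q * (1 - ρ)) * A N := by ring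
          _ = _ := by rw [hqρ, mul_one]
      rw [mul_sub, mul_add, mul_add, h2] at h1
      rw [pow_succ] at h1 ⊢
      linarith
  have hfin : ∀ N, γ * S N ≤ A 0 + 1 / (5 * L ^ 2) * (n * h0) := by
    intro N
    have h1 := htel N
    have h2 : 0 ≤ q ^ N * A N := mul_nonneg (by positivity) (hA N)
    -- With δτ = C - 1 and 2ρτ ≤ 1/10, the window adds at most 10/9 · (11/10) C, and 1 + 11/9 < 9/4.
    have h3 : γ ^ 2 * C * Γ N + γ ^ 2 * (δ + 2 * ρ * C)
        * (∑ t ∈ range N, q ^ t * (∑ u ∈ range t, if t ≤ u + τ then G u else 0))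
        ≤ 9 / 4 * (γ ^ 2 * C) * Γ N := by
      have h4 := mul_le_mul_of_nonneg_left (hwin N)
        (by positivity : 0 ≤ γ ^ 2 * (δ + 2 * ρ * C))
      have h5 : (δ + 2 * ρ * C) * τ ≤ C - 1 + 1 / 10 * C := by
        have h6 : δ * τ = C - 1 := by rw [hC]; ring
        have h7 : τ * ρ * C ≤ 1 / 20 * C := mul_le_mul_of_nonneg_right hτρ' (by linarith)
        linarith
      have h6 := mul_le_mul_of_nonneg_left h5 (mul_nonneg (sq_nonneg γ) (hΓ0 N))
      have h7 : 0 ≤ γ ^ 2 * Γ N := mul_nonneg (sq_nonneg γ) (hΓ0 N)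
      have h8 : γ ^ 2 * Γ N * 1 ≤ γ ^ 2 * Γ N * C := mul_le_mul_of_nonneg_left hC1 h7
      have h9 : 0 ≤ γ ^ 2 * Γ N * C := mul_nonneg h7 (by linarith)
      linarith
    have h4 : 2 * γ * S N ≤ A 0 + 9 / 4 * (γ ^ 2 * C) * Γ N := by
      have h5 : q * (2 * γ * S N) ≤ q * (A 0 + 9 / 4 * (γ ^ 2 * C) * Γ N) := by
        have h6 : A 0 ≤ q * A 0 := le_mul_of_one_le_left (hA 0) hq1
        have h7 := mul_le_mul_of_nonneg_left h3 hq0.le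
        linarith
      exact le_of_mul_le_mul_left h5 hq0
    have h5 := mul_le_mul_of_nonneg_left (hΓS N) (by positivity : 0 ≤ 9 / 4 * (γ ^ 2 * C))
    have h6 := mul_le_mul_of_nonneg_right hstep (mul_nonneg hγ.le (hS0 N))
    set R := γ * L * C * (1 + τ / n) with hR
    have hγC : γ * L ≤ 4 / 81 := by
      have ha : 1 ≤ C * (1 + τ / n) := by
        have : 0 ≤ (τ : ℝ) / n := by positivity
        nlinarith
      have hb : γ * L * 1 ≤ γ * L * (C * (1 + τ / n)) :=
        mul_le_mul_of_nonneg_left ha (by positivity)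
      have hc : γ * L * (C * (1 + τ / n)) = R := by rw [hR]; ring
      linarith
    -- The 81 in `hstep` is 4 · (9/4) · 9: since 81 R ≤ 4, the first term is at most γ S, half of
    -- the decrease 2γ S.
    have e1 : 9 / 4 * (γ ^ 2 * C) * (9 * L * (1 + τ / n) * S N + 5 / 2 * (n * (1 + τ / n)) * h0)
        = 81 * R * (γ * S N) / 4 + 45 / 8 * (R * γ / L * (n * h0)) := by
      rw [hR]; field_simp; ring
    have h7 : 45 / 8 * (R * γ / L * (n * h0)) ≤ 1 / (5 * L ^ 2) * (n * h0) := by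
      have ha : R * γ / L ≤ 8 / 225 * (1 / L ^ 2) := by
        rw [mul_one_div, div_le_div_iff₀ hL (by positivity)]
        have hR4 : R ≤ 4 / 81 := by linarith
        have : R * (γ * L) ≤ 4 / 81 * (4 / 81) := by gcongr
        nlinarith
      have hb : (0 : ℝ) ≤ n * h0 := by positivity
      have hc := mul_le_mul_of_nonneg_right ha hb
      have hd : 1 / (5 * L ^ 2) * (n * h0) = 45 / 8 * (8 / 225 * (1 / L ^ 2) * (n * h0)) := by
        field_simp; ring
      rw [hd]; linarith
    rw [e1] at h5
    linarith
  -- The bound on the whole weighted sum also bounds its last term.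
  have hterm : q ^ t * e t ≤ S (t + 1) :=
    single_le_sum (f := fun t => q ^ t * e t) (fun u _ => heq u) (self_mem_range_succ t)
  have h1 : q ^ t * (γ * e t) ≤ A 0 + 1 / (5 * L ^ 2) * (n * h0) := by
    have := mul_le_mul_of_nonneg_left hterm hγ.le
    have := hfin (t + 1)
    linarith
  have h2 := mul_le_mul_of_nonneg_left h1 (pow_nonneg hρpos.le t)
  rwa [← mul_assoc, ← mul_pow, mul_comm (1 - ρ) q, hqρ, one_pow, one_mul] at h2

end Sequences

/-! ### Rates and step sizes. -/

/-- Both sides are compared with exp(-cm); e^{-m} ≤ 1/(1+m) ≤ 1 - m/5 on [0, 1]. This converts the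
rate c·m into c·t sequential steps. -/
theorem one_sub_mul_le_rpow {m c : ℝ} (hm0 : 0 ≤ m) (hm1 : m ≤ 1) (hc : 0 < c) :
    1 - c * m ≤ (1 - 1 / 5 * m) ^ c := by
  have h1 : Real.exp (-m) ≤ 1 - 1 / 5 * m := by
    rw [Real.exp_neg]
    have h2 : m + 1 ≤ Real.exp m := Real.add_one_le_exp m
    calc (Real.exp m)⁻¹ ≤ (m + 1)⁻¹ := inv_anti₀ (by linarith) h2
      _ ≤ 1 - 1 / 5 * m := by
        rw [inv_le_iff_one_le_mul₀ (by linarith)]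
        nlinarith
  calc 1 - c * m ≤ Real.exp (-(c * m)) := Real.one_sub_le_exp_neg _
    _ = Real.exp (-m) ^ c := by rw [← Real.exp_mul]; congr 1; ring
    _ ≤ _ := Real.rpow_le_rpow (Real.exp_pos _).le h1 hc.le

namespace FiniteSumProblem

variable {n d : ℕ} (p : FiniteSumProblem n d)

theorem min_rate_pos : 0 < min (1 / (n : ℝ)) (1 / p.kappa) :=
  lt_min (one_div_pos.2 p.n_cast_pos) (one_div_pos.2 p.kappa_pos)

theorem min_rate_mul_n_le : min (1 / (n : ℝ)) (1 / p.kappa) * n ≤ 1 := by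
  have hn := p.n_cast_pos
  calc min (1 / (n : ℝ)) (1 / p.kappa) * n ≤ 1 / n * n := by gcongr; exact min_le_left _ _
    _ = 1 := by field_simp

theorem min_rate_le_one : min (1 / (n : ℝ)) (1 / p.kappa) ≤ 1 :=
  (min_le_left _ _).trans ((div_le_one p.n_cast_pos).2 p.one_le_n_cast)

theorem one_le_xi (τ : ℕ) : 1 ≤ p.xi τ := by
  have := p.kappa_pos
  rw [xi, Real.one_le_sqrt]
  have : 0 ≤ 1 / (8 * p.kappa) * min (1 / √p.Delta) (τ : ℝ) := by positivity
  linarith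

/-- For Δ = 0 the quotient `1 / √p.Delta` is 0 in Lean, but the product with √Δ vanishes anyway. -/
theorem tau_mul_sqrt_Delta_le {τ : ℕ} {B : ℝ} (hB : 0 ≤ B) (h : (τ : ℝ) ≤ 1 / √p.Delta * B) :
    τ * √p.Delta ≤ B := by
  rcases (Real.sqrt_nonneg p.Delta).eq_or_lt with h0 | h0
  · rw [← h0]; simpa using hB
  · rw [one_div_mul_eq_div, le_div_iff₀ h0] at h
    exact h

/-- The largest step size `aStar` is at least of order 1/max{1, n/κ}. The delicate term of the
product is τ√Δ times the square root `√y` in ξ. -/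
theorem one_add_mul_xi_le {τ : ℕ} {C : ℝ} (hC : 0 < C) (hτn : (τ : ℝ) < n / 10)
    (hτ : (τ : ℝ) ≤ C * (1 / √p.Delta * max 1 (n / p.kappa))) :
    (1 + τ * √p.Delta) * p.xi τ ≤ (3 + 2 * C) * max 1 (n / p.kappa) := by
  have hκ := p.kappa_pos
  have hn := p.n_cast_pos
  set X := max 1 ((n : ℝ) / p.kappa) with hX
  have hX1 : 1 ≤ X := le_max_left _ _
  have hXn : (n : ℝ) / p.kappa ≤ X := le_max_right _ _
  set δ := √p.Delta with hδ
  have hδ0 : 0 ≤ δ := Real.sqrt_nonneg _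
  have hτ0 : (0 : ℝ) ≤ τ := τ.cast_nonneg
  have hτδ : τ * δ ≤ C * X := p.tau_mul_sqrt_Delta_le (by positivity) (by linarith)
  set y := 1 / (8 * p.kappa) * min (1 / δ) (τ : ℝ) with hy
  have hm0 : 0 ≤ min (1 / δ) (τ : ℝ) := by positivity
  have hy0 : 0 ≤ y := by positivity
  have hξ : p.xi τ ≤ 1 + √y := by
    rw [xi, Real.sqrt_le_left (by positivity)]
    nlinarith [Real.sq_sqrt hy0, Real.sqrt_nonneg y]
  have hyκ : y ≤ min (1 / δ) (τ : ℝ) / p.kappa := by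
    rw [hy, one_div_mul_eq_div]
    gcongr
    linarith
  have hτκ : τ / p.kappa ≤ X :=
    le_trans (div_le_div_of_nonneg_right (by linarith) hκ.le) hXn
  have hyX : y ≤ X := hyκ.trans (le_trans (by gcongr; exact min_le_right _ _) hτκ)
  have h1 : √y ≤ X := by
    rw [Real.sqrt_le_left (by linarith)]
    nlinarith
  -- In the square, one factor δ cancels the minimum, which is at most 1/δ; what remains is τδ ≤ CX
  -- times τ/κ ≤ X, the latter from τ < n/10.
  have h2 : τ * δ * √y ≤ (1 + C) * X := by
    refine abs_le_of_sq_le_sq' ?_ (by positivity) |>.2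
    rw [mul_pow, Real.sq_sqrt hy0]
    have h3 : δ * min (1 / δ) (τ : ℝ) ≤ 1 := by
      refine (mul_le_mul_of_nonneg_left (min_le_left _ _) hδ0).trans ?_
      rw [mul_one_div]
      exact div_self_le_one δ
    calc (τ * δ) ^ 2 * y ≤ (τ * δ) ^ 2 * (min (1 / δ) (τ : ℝ) / p.kappa) := by gcongr
      _ = (τ * δ) * (τ / p.kappa) * (δ * min (1 / δ) (τ : ℝ)) := by ring
      _ ≤ (C * X) * X * 1 := by gcongr
      _ ≤ ((1 + C) * X) ^ 2 := by
        have : 0 ≤ X ^ 2 := by positivity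
        nlinarith [mul_nonneg hC.le this, mul_nonneg (sq_nonneg C) this]
  calc (1 + τ * δ) * p.xi τ ≤ (1 + τ * δ) * (1 + √y) := by gcongr
    _ = 1 + τ * δ + √y + τ * δ * √y := by ring
    _ ≤ X + C * X + X + (1 + C) * X := by gcongr
    _ = _ := by ring

theorem min_rate_mul_max_le :
    p.kappa * min (1 / (n : ℝ)) (1 / p.kappa) * max 1 ((n : ℝ) / p.kappa) ≤ 1 := by
  have hκ := p.kappa_pos
  have hn := p.n_cast_pos
  rcases max_choice 1 ((n : ℝ) / p.kappa) with h | h <;> rw [h]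
  · calc p.kappa * min (1 / (n : ℝ)) (1 / p.kappa) * 1 ≤ p.kappa * (1 / p.kappa) * 1 := by
          gcongr; exact min_le_right _ _
      _ = 1 := by field_simp
  · calc p.kappa * min (1 / (n : ℝ)) (1 / p.kappa) * (n / p.kappa)
          ≤ p.kappa * (1 / n) * (n / p.kappa) := by gcongr; exact min_le_left _ _
      _ = 1 := by field_simp

/-- This is the requirement 2ρ ≤ γμ for ρ = c·min{1/n, 1/κ}, and it dictates the constant c =
1/(64(3 + 2C)). -/
theorem two_mul_rate_le_aStar_div {τ : ℕ} {C : ℝ} (hC : 0 < C) (hτn : (τ : ℝ) < n / 10)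
    (hτ : (τ : ℝ) ≤ C * (1 / √p.Delta * max 1 (n / p.kappa))) :
    2 * (1 / (64 * (3 + 2 * C)) * min (1 / (n : ℝ)) (1 / p.kappa)) ≤ p.aStar τ / p.kappa := by
  have hκ := p.kappa_pos
  have h1 := p.one_add_mul_xi_le hC hτn hτ
  have hξ : 0 < p.xi τ := one_pos.trans_le (p.one_le_xi τ)
  have hX : 0 < max 1 ((n : ℝ) / p.kappa) := lt_max_of_lt_left one_pos
  have hmin := p.min_rate_mul_max_le
  rw [le_div_iff₀ hκ, aStar, mul_assoc 32]
  calc 2 * (1 / (64 * (3 + 2 * C)) * min (1 / (n : ℝ)) (1 / p.kappa)) * p.kappa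
      = 1 / (32 * (3 + 2 * C)) * (p.kappa * min (1 / (n : ℝ)) (1 / p.kappa)) := by
        field_simp; ring
    _ ≤ 1 / (32 * (3 + 2 * C)) * (1 / max 1 ((n : ℝ) / p.kappa)) := by
        gcongr
        rwa [le_div_iff₀ hX]
    _ = 1 / (32 * ((3 + 2 * C) * max 1 ((n : ℝ) / p.kappa))) := by field_simp
    _ ≤ _ := by gcongr

/-- A nonzero Δ is at least 1/n, so 1/√Δ ≤ n: for the universal step size this replaces the
hypothesis τ < n/10. -/
theorem tau_div_n_le {τ : ℕ} {C : ℝ} (hC : 0 < C) (hτ : (τ : ℝ) ≤ C * (1 / √p.Delta)) :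
    (τ : ℝ) / n ≤ C := by
  have hn := p.n_cast_pos
  have hn1 := p.one_le_n_cast
  rw [div_le_iff₀ hn]
  refine hτ.trans (mul_le_mul_of_nonneg_left ?_ hC.le)
  rcases eq_or_ne p.Delta 0 with h | h
  · simp [h]
  · have h1 := p.one_div_le_Delta h
    have h2 : 1 / (n : ℝ) ≤ √p.Delta := by
      refine Real.le_sqrt_of_sq_le (le_trans ?_ h1)
      have : 1 / (n : ℝ) ≤ 1 := (div_le_one hn).2 hn1
      have : 0 < 1 / (n : ℝ) := by positivity
      nlinarith
    have h3 := one_div_le_one_div_of_le (by positivity) h2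
    rwa [one_div_one_div] at h3

/-- The geometric bound has prefactor 1/γ; the factor n of the claim is slack, whence K = 1. -/
theorem matchesSagaRate_of_geometric {γ : ℝ} {Ω : Type*} [MeasurableSpace Ω] {P : Measure Ω}
    {xhat : ℕ → Ω → Vec d} {c : ℝ} (hγ : 0 < γ) (hc0 : 0 < c) (hc1 : c ≤ 1)
    (hint : ∀ t, Integrable (fun ω => p.objective (xhat t ω)) P)
    (h : ∀ t, γ * ((∫ ω, p.objective (xhat t ω) ∂P) - p.objective p.xstar)
      ≤ (1 - c * min (1 / (n : ℝ)) (1 / p.kappa)) ^ t * p.initialError) :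
    MatchesSagaRate p γ P xhat c 1 := by
  intro t
  have hm0 := p.min_rate_pos
  have hm1 := p.min_rate_le_one
  have hsaga : p.sagaRate = 1 / 5 * min (1 / (n : ℝ)) (1 / p.kappa) := rfl
  set m := min (1 / (n : ℝ)) (1 / p.kappa)
  have hcm : 0 ≤ 1 - c * m := by nlinarith
  have hn1 := p.one_le_n_cast
  have hC0 := p.initialError_nonneg
  have hB0 : 0 ≤ 1 * (n / γ) * p.initialError := by positivity
  have h1 : (∫ ω, p.objective (xhat t ω) ∂P) - p.objective p.xstar ≤
      (1 - c * m) ^ t * (1 * (n / γ) * p.initialError) := by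
    have h2 : (∫ ω, p.objective (xhat t ω) ∂P) - p.objective p.xstar
        ≤ (1 - c * m) ^ t * p.initialError / γ := by
      rw [le_div_iff₀ hγ, mul_comm]; exact h t
    refine h2.trans ?_
    rw [mul_div_assoc]
    gcongr
    rw [one_mul, div_mul_eq_mul_div]
    gcongr
    exact le_mul_of_one_le_left hC0 hn1
  refine ⟨hint t, h1, h1.trans (mul_le_mul_of_nonneg_right ?_ hB0)⟩
  rw [hsaga, Real.rpow_mul (by linarith), Real.rpow_natCast]
  exact pow_le_pow_left₀ hcm (one_sub_mul_le_rpow hm0.le hm1 hc0) t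

end FiniteSumProblem

/-! ### Finitely valued random variables. -/

section FinitelyValued

/-- `X` is measurable with respect to `m` and takes finitely many values. -/
structure IsFinitelyValued {Ω β : Type*} [MeasurableSpace β] (m : MeasurableSpace Ω)
    (X : Ω → β) : Prop where
  measurable : Measurable[m] X
  finite_range : (Set.range X).Finite

namespace IsFinitelyValued

variable {Ω β β' : Type*} [MeasurableSpace β] [MeasurableSpace β'] {m m' : MeasurableSpace Ω}

theorem mono {X : Ω → β} (hX : IsFinitelyValued m X) (h : m ≤ m') : IsFinitelyValued m' X :=
  ⟨hX.measurable.mono h le_rfl, hX.finite_range⟩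

theorem comp {X : Ω → β} (hX : IsFinitelyValued m X) {g : β → β'} (hg : Measurable g) :
    IsFinitelyValued m fun ω => g (X ω) :=
  ⟨hg.comp hX.measurable, by
    have : Set.range (fun ω => g (X ω)) = g '' Set.range X := Set.range_comp g X
    rw [this]; exact hX.finite_range.image g⟩

theorem const (c : β) : IsFinitelyValued m fun _ => c :=
  ⟨measurable_const, Set.finite_range_const⟩

theorem prodMk {X : Ω → β} {Y : Ω → β'} (hX : IsFinitelyValued m X) (hY : IsFinitelyValued m Y) :
    IsFinitelyValued m fun ω => (X ω, Y ω) :=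
  ⟨hX.measurable.prodMk hY.measurable, (hX.finite_range.prod hY.finite_range).subset <| by
    rintro _ ⟨ω, rfl⟩; exact ⟨⟨ω, rfl⟩, ⟨ω, rfl⟩⟩⟩

theorem comp₂ {X : Ω → β} {Y : Ω → β'} {β'' : Type*} [MeasurableSpace β'']
    (hX : IsFinitelyValued m X) (hY : IsFinitelyValued m Y)
    {g : β → β' → β''} (hg : Measurable (Function.uncurry g)) :
    IsFinitelyValued m fun ω => g (X ω) (Y ω) :=
  (hX.prodMk hY).comp hg

theorem add [Add β] [MeasurableAdd₂ β] {X Y : Ω → β} (hX : IsFinitelyValued m X)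
    (hY : IsFinitelyValued m Y) : IsFinitelyValued m fun ω => X ω + Y ω :=
  hX.comp₂ hY measurable_add

theorem sub [Sub β] [MeasurableSub₂ β] {X Y : Ω → β} (hX : IsFinitelyValued m X)
    (hY : IsFinitelyValued m Y) : IsFinitelyValued m fun ω => X ω - Y ω :=
  hX.comp₂ hY measurable_sub

theorem mul {X Y : Ω → ℝ} (hX : IsFinitelyValued m X)
    (hY : IsFinitelyValued m Y) : IsFinitelyValued m fun ω => X ω * Y ω :=
  hX.comp₂ hY measurable_mul

theorem sum [AddCommMonoid β] [MeasurableAdd₂ β] {ι : Type*} (s : Finset ι) {X : ι → Ω → β}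
    (hX : ∀ i ∈ s, IsFinitelyValued m (X i)) : IsFinitelyValued m fun ω => ∑ i ∈ s, X i ω := by
  classical
  induction s using Finset.induction_on with
  | empty => simpa using const (0 : β)
  | insert a s ha ih =>
    simp only [Finset.sum_insert ha]
    exact (hX a (Finset.mem_insert_self a s)).add
      (ih fun i hi => hX i (Finset.mem_insert_of_mem hi))

theorem ite {A : Ω → Prop} [DecidablePred A] (hA : MeasurableSet[m] {ω | A ω}) {X Y : Ω → β}
    (hX : IsFinitelyValued m X) (hY : IsFinitelyValued m Y) :
    IsFinitelyValued m fun ω => if A ω then X ω else Y ω :=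
  ⟨Measurable.ite hA hX.measurable hY.measurable,
    (hX.finite_range.union hY.finite_range).subset <| by
      rintro _ ⟨ω, rfl⟩
      dsimp only
      split_ifs
      · exact Or.inl ⟨ω, rfl⟩
      · exact Or.inr ⟨ω, rfl⟩⟩

/-- The purpose of the notion: every integrability condition below reduces to it. -/
theorem integrable {mΩ : MeasurableSpace Ω} {P : Measure Ω} [IsFiniteMeasure P] {X : Ω → ℝ}
    (hX : IsFinitelyValued m X) (hm : m ≤ mΩ) : Integrable X P := by
  obtain ⟨C, hC⟩ := (hX.finite_range.image fun r => ‖r‖).bddAbove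
  refine Integrable.of_bound (hX.measurable.mono hm le_rfl).aestronglyMeasurable C ?_
  exact Filter.Eventually.of_forall fun ω => hC ⟨X ω, ⟨ω, rfl⟩, rfl⟩

end IsFinitelyValued

end FinitelyValued

/-! ### The past of an iteration and independence of the sampled index. -/

namespace IsAsagaRun

variable {n d : ℕ} {Ω : Type*} {idx : ℕ → Ω → Fin n} {xhat : ℕ → Ω → Vec d}
  {ahat : ℕ → Ω → Fin n → Vec d}

/-- The information generated by the indices sampled before iteration `t` and everything read up to
and including iteration `t`. -/
@[reducible]
def past (idx : ℕ → Ω → Fin n) (xhat : ℕ → Ω → Vec d) (ahat : ℕ → Ω → Fin n → Vec d) (t : ℕ) :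
    MeasurableSpace Ω :=
  MeasurableSpace.comap (fun ω => ((fun u : Fin t => idx u ω), (fun u : Fin (t + 1) => xhat u ω),
    (fun u : Fin (t + 1) => ahat u ω))) inferInstance

theorem measurable_history (t : ℕ) : Measurable[past idx xhat ahat t]
    (fun ω => ((fun u : Fin t => idx u ω), (fun u : Fin (t + 1) => xhat u ω),
      (fun u : Fin (t + 1) => ahat u ω))) :=
  comap_measurable _

theorem measurable_idx_past {u t : ℕ} (hu : u < t) : Measurable[past idx xhat ahat t] (idx u) :=
  ((measurable_pi_apply (⟨u, hu⟩ : Fin t)).comp measurable_fst).comp (measurable_history t)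

theorem measurable_xhat_past {u t : ℕ} (hu : u ≤ t) : Measurable[past idx xhat ahat t] (xhat u) :=
  ((measurable_pi_apply (⟨u, Nat.lt_succ_of_le hu⟩ : Fin (t + 1))).comp
    (measurable_fst.comp measurable_snd)).comp (measurable_history t)

theorem measurable_ahat_past {u t : ℕ} (hu : u ≤ t) : Measurable[past idx xhat ahat t] (ahat u) :=
  ((measurable_pi_apply (⟨u, Nat.lt_succ_of_le hu⟩ : Fin (t + 1))).comp
    (measurable_snd.comp measurable_snd)).comp (measurable_history t)

theorem past_mono {s t : ℕ} (hst : s ≤ t) : past idx xhat ahat s ≤ past idx xhat ahat t := by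
  let _ : MeasurableSpace Ω := past idx xhat ahat t
  refine Measurable.comap_le ?_
  exact (measurable_pi_iff.2 fun u : Fin s => measurable_idx_past (by omega)).prodMk
    ((measurable_pi_iff.2 fun u : Fin (s + 1) => measurable_xhat_past (by omega)).prodMk
      (measurable_pi_iff.2 fun u : Fin (s + 1) => measurable_ahat_past (by omega)))

theorem measurableSet_idx_eq {u t : ℕ} (hu : u < t) (j : Fin n) :
    MeasurableSet[past idx xhat ahat t] {ω | idx u ω = j} :=
  measurable_idx_past hu (measurableSet_singleton j)

/-- The event that the index `j` is not sampled during the iterations in `[a, b)`. -/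
def avoid (idx : ℕ → Ω → Fin n) (j : Fin n) (a b : ℕ) : Set Ω :=
  {ω | ∀ w ∈ Finset.Ico a b, idx w ω ≠ j}

open Classical in
theorem isFinitelyValued_ite_avoid (j : Fin n) {a b : ℕ} (hab : a ≤ b) {X : Ω → ℝ}
    (hX : IsFinitelyValued (past idx xhat ahat a) X) :
    IsFinitelyValued (past idx xhat ahat b)
      (fun ω => if ω ∈ avoid idx j a b then X ω else 0) := by
  refine IsFinitelyValued.ite ?_ (hX.mono (past_mono hab)) (IsFinitelyValued.const 0)
  have : {ω | ω ∈ avoid idx j a b}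
      = ⋂ w ∈ Finset.Ico a b, {ω | idx w ω = j}ᶜ := by
    ext ω; simp [avoid]
  rw [this]
  refine MeasurableSet.biInter (Set.to_countable _) fun w hw => MeasurableSet.compl ?_
  exact measurableSet_idx_eq (Finset.mem_Ico.1 hw).2 j

variable {p : FiniteSumProblem n d} {γ : ℝ} {τ : ℕ} [mΩ : MeasurableSpace Ω] {P : Measure Ω}
  {T : ℕ → Ω → IterationTimes n d}

theorem past_le (h : IsAsagaRun p γ τ P idx xhat ahat T) (t : ℕ) :
    past idx xhat ahat t ≤ mΩ := by
  refine Measurable.comap_le ?_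
  exact (measurable_pi_iff.2 fun u : Fin t => h.measurable_idx u).prodMk
    ((measurable_pi_iff.2 fun u : Fin (t + 1) => h.measurable_xhat u).prodMk
      (measurable_pi_iff.2 fun u : Fin (t + 1) => h.measurable_ahat u))

theorem integral_ite_idx [IsProbabilityMeasure P] (h : IsAsagaRun p γ τ P idx xhat ahat T)
    (t : ℕ) (j : Fin n)
    {X : Ω → ℝ} (hX : IsFinitelyValued (past idx xhat ahat t) X) :
    ∫ ω, (if idx t ω = j then X ω else 0) ∂P = (n : ℝ)⁻¹ * ∫ ω, X ω ∂P := by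
  have hind : IndepFun (idx t) X P :=
    indep_of_indep_of_le_right ((IndepFun_iff_Indep _ _ _).1 (h.indep t))
      (measurable_iff_comap_le.1 hX.measurable)
  let φ : Fin n → ℝ := fun i => if i = j then 1 else 0
  have hφ : Measurable φ := measurable_of_finite φ
  have h1 : IndepFun (fun ω => φ (idx t ω)) X P := hind.comp hφ measurable_id
  have h2 := h1.integral_fun_mul_eq_mul_integral
    (hφ.comp (h.measurable_idx t)).aestronglyMeasurable
    (hX.integrable (h.past_le t)).aestronglyMeasurable
  have h3 : ∫ ω, φ (idx t ω) ∂P = (n : ℝ)⁻¹ := by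
    have hset : MeasurableSet {ω | idx t ω = j} := h.measurable_idx t (measurableSet_singleton j)
    have e : (fun ω => φ (idx t ω)) = Set.indicator {ω | idx t ω = j} 1 := by
      funext ω
      simp [φ, Set.indicator_apply]
    rw [e, integral_indicator_one hset, measureReal_def, h.uniform]
    simp
  rw [h3] at h2
  rw [← h2]
  refine integral_congr_ae (Filter.Eventually.of_forall fun ω => ?_)
  simp [φ]

/-- This plays the role of the conditional expectation given the past: the fresh index is averaged
out while everything else is frozen. -/
theorem integral_comp_idx [IsProbabilityMeasure P] (h : IsAsagaRun p γ τ P idx xhat ahat T)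
    (t : ℕ) {X : Fin n → Ω → ℝ} (hX : ∀ j, IsFinitelyValued (past idx xhat ahat t) (X j)) :
    ∫ ω, X (idx t ω) ω ∂P = (n : ℝ)⁻¹ * ∑ j, ∫ ω, X j ω ∂P := by
  have e : ∀ ω, X (idx t ω) ω = ∑ j, if idx t ω = j then X j ω else 0 := fun ω => by simp
  simp only [e]
  rw [integral_finsetSum, Finset.mul_sum]
  · exact Finset.sum_congr rfl fun j _ => h.integral_ite_idx t j (hX j)
  · intro j _
    exact (IsFinitelyValued.ite (measurableSet_idx_eq (Nat.lt_succ_self t) j)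
      ((hX j).mono (past_mono (Nat.le_succ t))) (IsFinitelyValued.const 0)).integrable
        (h.past_le (t + 1))

open Classical in
/-- A fixed index is avoided by `b - a` consecutive samples with probability
`(1 - 1 / n) ^ (b - a)`, independently of the past. -/
theorem integral_ite_avoid [IsProbabilityMeasure P]
    (h : IsAsagaRun p γ τ P idx xhat ahat T) (j : Fin n) {a : ℕ} {X : Ω → ℝ}
    (hX : IsFinitelyValued (past idx xhat ahat a) X) (b : ℕ) :
    ∫ ω, (if ω ∈ avoid idx j a b then X ω else 0) ∂P
      = (1 - 1 / (n : ℝ)) ^ (b - a) * ∫ ω, X ω ∂P := by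
  induction b with
  | zero => simp [avoid]
  | succ b ih =>
    rcases lt_or_ge b a with hba | hab
    · simp [avoid, Finset.Ico_eq_empty_of_le (Nat.succ_le_of_lt hba), Nat.sub_eq_zero_of_le
        (Nat.succ_le_of_lt hba)]
    · have hY := isFinitelyValued_ite_avoid j hab hX
      -- Avoiding j up to b inclusive is avoiding it before b, minus the part where b samples j; the
      -- latter has relative weight 1/n.
      have e : ∀ ω, (if ω ∈ avoid idx j a (b + 1) then X ω else 0)
          = (if ω ∈ avoid idx j a b then X ω else 0)
            - if idx b ω = j then
                (if ω ∈ avoid idx j a b then X ω else 0) else 0 := by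
        intro ω
        have h1 : ω ∈ avoid idx j a (b + 1) ↔ idx b ω ≠ j ∧ ω ∈ avoid idx j a b := by
          simp only [avoid, Set.mem_ofPred_eq, ← Finset.insert_Ico_right_eq_Ico_add_one hab,
            Finset.forall_mem_insert]
        by_cases h2 : idx b ω = j <;> simp [h1, h2]
      rw [integral_congr_ae (Filter.Eventually.of_forall e),
        integral_sub (hY.integrable (h.past_le b)), h.integral_ite_idx b j hY, ih,
        Nat.succ_sub hab, pow_succ]
      · ring
      · exact (IsFinitelyValued.ite (measurableSet_idx_eq (Nat.lt_succ_self b) j)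
          (hY.mono (past_mono (Nat.le_succ b))) (IsFinitelyValued.const 0)).integrable
            (h.past_le (b + 1))

end IsAsagaRun

/-! ### Pathwise consequences of the memory model. -/

theorem Set.Finite.range_comp_of_range {Ω β β' : Type*} {X : Ω → β} (hX : (Set.range X).Finite)
    (F : β → β') : (Set.range fun ω => F (X ω)).Finite := by
  have : (Set.range fun ω => F (X ω)) = F '' Set.range X := Set.range_comp F X
  rw [this]
  exact hX.image F

theorem Set.finite_range_of_apply {Ω ι : Type*} [Finite ι] {β : ι → Type*} {X : Ω → ∀ i, β i}
    (hX : ∀ i, (Set.range fun ω => X ω i).Finite) : (Set.range X).Finite :=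
  (Set.Finite.pi' hX).subset <| by
    rintro _ ⟨ω, rfl⟩ i
    exact ⟨ω, rfl⟩

theorem Set.finite_range_vec {Ω : Type*} {d : ℕ} {X : Ω → Vec d}
    (hX : ∀ v, (Set.range fun ω => X ω v).Finite) : (Set.range X).Finite :=
  (Set.finite_range_of_apply hX).range_comp_of_range (WithLp.toLp 2)

namespace IsAsagaRun

variable {n d : ℕ} {Ω : Type*} {p : FiniteSumProblem n d} {γ : ℝ} {τ : ℕ}
  {idx : ℕ → Ω → Fin n} {xhat : ℕ → Ω → Vec d} {ahat : ℕ → Ω → Fin n → Vec d}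

variable (p idx xhat ahat) in
/-- The direction of the update computed by iteration `t`. -/
noncomputable def dir (t : ℕ) (ω : Ω) : Vec d := p.direction (xhat t ω) (ahat t ω) (idx t ω)

variable (p γ idx xhat ahat) in
/-- The virtual iterate: the result of the complete updates of all iterations `u < t`. -/
noncomputable def virtual (t : ℕ) (ω : Ω) : Vec d :=
  p.x0 - γ • ∑ u ∈ Finset.range t, dir p idx xhat ahat u ω

variable (p idx xhat ahat) in
/-- The overlap `∑ v, |[g u]_v| |[g w]_v|` of two directions. -/
noncomputable def cross (u w : ℕ) (ω : Ω) : ℝ :=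
  ∑ v, |dir p idx xhat ahat u ω v| * |dir p idx xhat ahat w ω v|

/-- The iterations that may overlap with iteration `t` and precede it. -/
def window (τ t : ℕ) : Finset ℕ := (Finset.range t).filter fun u => t ≤ u + τ

theorem mem_window {t u : ℕ} : u ∈ window τ t ↔ u < t ∧ t ≤ u + τ := by
  simp [window]

theorem card_window_le (t : ℕ) : (window τ t).card ≤ τ := by
  have : window τ t ⊆ Finset.Ico (t - τ) t := fun u hu => by
    rw [mem_window] at hu
    rw [Finset.mem_Ico]
    omega
  refine (Finset.card_le_card this).trans ?_
  rw [Nat.card_Ico]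
  omega

theorem cross_comm (u w : ℕ) (ω : Ω) :
    cross p idx xhat ahat u w ω = cross p idx xhat ahat w u ω :=
  Finset.sum_congr rfl fun _ _ => mul_comm _ _

theorem cross_self (u : ℕ) (ω : Ω) :
    cross p idx xhat ahat u u ω = ‖dir p idx xhat ahat u ω‖ ^ 2 := by
  rw [cross, EuclideanSpace.real_norm_sq_eq]
  exact Finset.sum_congr rfl fun v _ => abs_mul_abs_self _ |>.trans (sq _).symm

variable [mΩ : MeasurableSpace Ω] {P : Measure Ω} {T : ℕ → Ω → IterationTimes n d}

theorem writeX_lt_readX (h : IsAsagaRun p γ τ P idx xhat ahat T)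
    {t u : ℕ} (hu : u + τ + 1 ≤ t) {ω : Ω} {v : Fin d}
    (hv : v ∈ p.supp (idx u ω)) : (T u ω).writeX v < (T t ω).readX v :=
  ((h.ordered u ω).writeX_le_finish v hv).trans_lt
    ((h.overlap ω u t hu).trans_le ((h.ordered t ω).start_le_readX v))

theorem writeA_lt_readA (h : IsAsagaRun p γ τ P idx xhat ahat T)
    {t u : ℕ} (hu : u + τ + 1 ≤ t) {ω : Ω} {v : Fin d} (j : Fin n)
    (hv : v ∈ p.supp (idx u ω)) : (T u ω).writeA v < (T t ω).readA j v :=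
  ((h.ordered u ω).writeA_le_finish v hv).trans_lt
    ((h.overlap ω u t hu).trans_le ((h.ordered t ω).start_le_readA j v))

theorem writeA_lt_writeA (h : IsAsagaRun p γ τ P idx xhat ahat T)
    {t u : ℕ} (hu : u + τ + 1 ≤ t) {ω : Ω} {v : Fin d}
    (hv : v ∈ p.supp (idx u ω)) (hv' : v ∈ p.supp (idx t ω)) :
    (T u ω).writeA v < (T t ω).writeA v :=
  ((h.ordered u ω).writeA_le_finish v hv).trans_lt
    ((h.overlap ω u t hu).trans_le ((h.ordered t ω).start_le_readEnd.trans
      ((h.ordered t ω).readEnd_le_writeA v hv')))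

/-- Among the finitely many visible writes to a cell one is latest, so the two rules for reading the
table are exhaustive. -/
theorem ahat_cases (h : IsAsagaRun p γ τ P idx xhat ahat T)
    (t : ℕ) (ω : Ω) (j : Fin n) (v : Fin d) :
    (ahat t ω j v = p.a0 j v ∧
      ∀ u < t, ¬ (idx u ω = j ∧ v ∈ p.supp j ∧ (T u ω).writeA v < (T t ω).readA j v)) ∨
    ∃ u < t, (idx u ω = j ∧ v ∈ p.supp j ∧ (T u ω).writeA v < (T t ω).readA j v) ∧
      (∀ w < t, idx w ω = j → (T w ω).writeA v < (T t ω).readA j v →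
        (T w ω).writeA v ≤ (T u ω).writeA v) ∧
      ahat t ω j v = gradient (p.f j) (xhat u ω) v := by
  classical
  let s := (Finset.range t).filter fun u =>
    idx u ω = j ∧ v ∈ p.supp j ∧ (T u ω).writeA v < (T t ω).readA j v
  rcases s.eq_empty_or_nonempty with hs | hs
  · left
    have hs' : ∀ u < t, ¬ (idx u ω = j ∧ v ∈ p.supp j ∧
        (T u ω).writeA v < (T t ω).readA j v) := fun u hu =>
      Finset.filter_eq_empty_iff.1 hs (Finset.mem_range.2 hu)
    exact ⟨h.ahat_init t ω j v hs', hs'⟩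
  · right
    obtain ⟨u, hu, hmax⟩ := s.exists_max_image (fun u => (T u ω).writeA v) hs
    obtain ⟨hut, hw⟩ := Finset.mem_filter.1 hu
    rw [Finset.mem_range] at hut
    have hmax' : ∀ w < t, idx w ω = j → (T w ω).writeA v < (T t ω).readA j v →
        (T w ω).writeA v ≤ (T u ω).writeA v := fun w hwt hwj hwr =>
      hmax w (Finset.mem_filter.2 ⟨Finset.mem_range.2 hwt, hwj, hw.2.1, hwr⟩)
    exact ⟨u, hut, hw, hmax', h.ahat_last t ω j v u hut hw.1 hw.2.1 hw.2.2 hmax'⟩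

theorem isSupported_ahat (h : IsAsagaRun p γ τ P idx xhat ahat T)
    (t : ℕ) (ω : Ω) : p.IsSupported (ahat t ω) := by
  intro j v hv
  rw [h.ahat_init t ω j v fun u _ hu => hv hu.2.1]
  exact FiniteSumProblem.isSupported_a0 j v hv

theorem dir_apply_eq_zero (h : IsAsagaRun p γ τ P idx xhat ahat T)
    {t : ℕ} {ω : Ω} {v : Fin d} (hv : v ∉ p.supp (idx t ω)) :
    dir p idx xhat ahat t ω v = 0 :=
  FiniteSumProblem.direction_apply_eq_zero (h.isSupported_ahat t ω) hv _

/-- An update that is more than τ labels old is finished before the read starts, and off its support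
it is zero. Which of the recent updates are missed may differ from coordinate to coordinate, so only
absolute values can be controlled. -/
theorem abs_xhat_sub_virtual_le (h : IsAsagaRun p γ τ P idx xhat ahat T)
    (hγ : 0 ≤ γ) (t : ℕ) (ω : Ω) (v : Fin d) :
    |xhat t ω v - virtual p γ idx xhat ahat t ω v|
      ≤ γ * ∑ u ∈ window τ t, |dir p idx xhat ahat u ω v| := by
  classical
  have e : xhat t ω v - virtual p γ idx xhat ahat t ω v
      = ∑ u ∈ window τ t, if v ∈ p.supp (idx u ω) ∧ (T u ω).writeX v < (T t ω).readX v
        then 0 else γ * dir p idx xhat ahat u ω v := by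
    have e1 : xhat t ω v - virtual p γ idx xhat ahat t ω v
        = ∑ u ∈ Finset.range t, ((if v ∈ p.supp (idx u ω) ∧ (T u ω).writeX v < (T t ω).readX v
          then -γ * dir p idx xhat ahat u ω v else 0) + γ * dir p idx xhat ahat u ω v) := by
      rw [h.xhat_eq, Finset.sum_add_distrib, ← Finset.mul_sum]
      simp only [virtual, dir, WithLp.ofLp_sub, WithLp.ofLp_smul, WithLp.ofLp_sum, Pi.sub_apply,
        Pi.smul_apply, Finset.sum_apply, smul_eq_mul]
      ring
    rw [e1, window, Finset.sum_filter]
    refine Finset.sum_congr rfl fun u _ => ?_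
    by_cases hv : v ∈ p.supp (idx u ω)
    · by_cases hu : t ≤ u + τ
      · rw [if_pos hu]
        split_ifs <;> ring
      · rw [if_neg hu, if_pos ⟨hv, h.writeX_lt_readX (by omega) hv⟩]
        ring
    · rw [h.dir_apply_eq_zero hv]
      simp
  rw [e, Finset.mul_sum]
  refine (Finset.abs_sum_le_sum_abs _ _).trans (Finset.sum_le_sum fun u _ => ?_)
  split_ifs
  · simpa using mul_nonneg hγ (abs_nonneg _)
  · rw [abs_mul, abs_of_nonneg hγ]

/-- The initial values are deterministic and each read selects from finitely many earlier writes, so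
finiteness propagates by induction. -/
theorem finite_range_state (h : IsAsagaRun p γ τ P idx xhat ahat T)
    (t : ℕ) : (Set.range fun ω => (xhat t ω, ahat t ω)).Finite := by
  classical
  induction t using Nat.strong_induction_on with
  | _ t ih =>
    have hX : ∀ u < t, (Set.range (xhat u)).Finite := fun u hu =>
      (ih u hu).range_comp_of_range Prod.fst
    have hdir : ∀ u < t, ∀ v,
        (Set.range fun ω => p.direction (xhat u ω) (ahat u ω) (idx u ω) v).Finite := by
      intro u hu v
      have h1 : (Set.range fun ω => ((xhat u ω, ahat u ω), idx u ω)).Finite :=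
        ((ih u hu).prod (Set.toFinite (Set.range (idx u)))).subset <| by
          rintro _ ⟨ω, rfl⟩
          exact ⟨⟨ω, rfl⟩, ⟨ω, rfl⟩⟩
      exact h1.range_comp_of_range fun s => p.direction s.1.1 s.1.2 s.2 v
    have hx : (Set.range (xhat t)).Finite := by
      refine Set.finite_range_vec fun v => ?_
      simp only [h.xhat_eq]
      -- The σ-algebra ⊤ is used because the access times need not be measurable; only the
      -- finiteness of the range is retained.
      have h1 : IsFinitelyValued (⊤ : MeasurableSpace Ω) fun ω => ∑ u ∈ Finset.range t,
          if v ∈ p.supp (idx u ω) ∧ (T u ω).writeX v < (T t ω).readX v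
          then -γ * p.direction (xhat u ω) (ahat u ω) (idx u ω) v else 0 := by
        refine IsFinitelyValued.sum _ fun u hu => ?_
        refine IsFinitelyValued.ite MeasurableSpace.measurableSet_top ?_ (IsFinitelyValued.const 0)
        exact (IsFinitelyValued.const (-γ)).mul
          ⟨measurable_from_top, hdir u (Finset.mem_range.1 hu) v⟩
      exact h1.finite_range.range_comp_of_range fun r => p.x0 v + r
    have ha : (Set.range (ahat t)).Finite := by
      refine Set.finite_range_of_apply fun j => Set.finite_range_vec fun v => ?_
      have h1 : (⋃ u ∈ Finset.range t,
          Set.range fun ω => gradient (p.f j) (xhat u ω) v).Finite := by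
        refine Set.Finite.biUnion (Finset.finite_toSet _) fun u hu => ?_
        exact (hX u (Finset.mem_range.1 hu)).range_comp_of_range
          fun x => gradient (p.f j) x v
      refine ((Set.finite_singleton (p.a0 j v)).union h1).subset ?_
      rintro _ ⟨ω, rfl⟩
      rcases h.ahat_cases t ω j v with hc | ⟨u, hu, -, -, hc⟩
      · exact Or.inl hc.1
      · exact Or.inr (Set.mem_biUnion (Finset.mem_range.2 hu) ⟨ω, hc.symm⟩)
    exact (hx.prod ha).subset <| by
      rintro _ ⟨ω, rfl⟩
      exact ⟨⟨ω, rfl⟩, ⟨ω, rfl⟩⟩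

end IsAsagaRun

/-! ### Expectations: unbiasedness, second moments and overlaps of directions. -/

theorem FiniteSumProblem.continuous_reweight {n d : ℕ} (p : FiniteSumProblem n d) (i : Fin n) :
    Continuous (p.reweight i) := by
  classical
  unfold FiniteSumProblem.reweight
  refine (PiLp.continuous_toLp 2 _).comp (continuous_pi fun v => ?_)
  split_ifs
  · fun_prop
  · exact continuous_const

theorem FiniteSumProblem.measurable_direction {n d : ℕ} (p : FiniteSumProblem n d) (i : Fin n) :
    Measurable (Function.uncurry fun (x : Vec d) (α : Fin n → Vec d) => p.direction x α i) := by
  have h1 := p.continuous_gradient i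
  have h2 := p.continuous_reweight i
  have : Continuous
      (Function.uncurry fun (x : Vec d) (α : Fin n → Vec d) => p.direction x α i) := by
    simp only [FiniteSumProblem.direction, Function.uncurry_def]
    fun_prop
  exact this.measurable

namespace IsFinitelyValued

variable {Ω : Type*} {m : MeasurableSpace Ω} {d : ℕ} {X Y : Ω → Vec d}

theorem real_inner (hX : IsFinitelyValued m X) (hY : IsFinitelyValued m Y) :
    IsFinitelyValued m fun ω => inner ℝ (X ω) (Y ω) :=
  hX.comp₂ hY (g := fun x y => inner ℝ x y) (by
    simp only [Function.uncurry_def]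
    exact (measurable_fst.inner measurable_snd))

theorem norm_sq (hX : IsFinitelyValued m X) : IsFinitelyValued m fun ω => ‖X ω‖ ^ 2 :=
  hX.comp (g := fun x => ‖x‖ ^ 2) (by fun_prop)

theorem vec_apply (hX : IsFinitelyValued m X) (v : Fin d) : IsFinitelyValued m fun ω => X ω v :=
  hX.comp (g := fun x : Vec d => x v) (by fun_prop)

end IsFinitelyValued

namespace IsAsagaRun

variable {n d : ℕ} {Ω : Type*} {p : FiniteSumProblem n d} {γ : ℝ} {τ : ℕ}
  [mΩ : MeasurableSpace Ω] {P : Measure Ω} {idx : ℕ → Ω → Fin n} {xhat : ℕ → Ω → Vec d}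
  {ahat : ℕ → Ω → Fin n → Vec d} {T : ℕ → Ω → IterationTimes n d}

theorem isFinitelyValued_xhat (h : IsAsagaRun p γ τ P idx xhat ahat T) {u t : ℕ} (hu : u ≤ t) :
    IsFinitelyValued (past idx xhat ahat t) (xhat u) :=
  ⟨measurable_xhat_past hu, (h.finite_range_state u).range_comp_of_range Prod.fst⟩

theorem isFinitelyValued_ahat (h : IsAsagaRun p γ τ P idx xhat ahat T) {u t : ℕ} (hu : u ≤ t) :
    IsFinitelyValued (past idx xhat ahat t) (ahat u) :=
  ⟨measurable_ahat_past hu, (h.finite_range_state u).range_comp_of_range Prod.snd⟩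

theorem isFinitelyValued_ahat_apply (h : IsAsagaRun p γ τ P idx xhat ahat T) {u t : ℕ}
    (hu : u ≤ t) (j : Fin n) :
    IsFinitelyValued (past idx xhat ahat t) fun ω => ahat u ω j :=
  (h.isFinitelyValued_ahat hu).comp (measurable_pi_apply j)

theorem isFinitelyValued_direction (h : IsAsagaRun p γ τ P idx xhat ahat T) {u t : ℕ} (hu : u ≤ t)
    (j : Fin n) :
    IsFinitelyValued (past idx xhat ahat t) fun ω => p.direction (xhat u ω) (ahat u ω) j :=
  (h.isFinitelyValued_xhat hu).comp₂ (h.isFinitelyValued_ahat hu)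
    (g := fun x α => p.direction x α j) (p.measurable_direction j)

theorem isFinitelyValued_dir (h : IsAsagaRun p γ τ P idx xhat ahat T) {u t : ℕ} (hu : u < t) :
    IsFinitelyValued (past idx xhat ahat t) (dir p idx xhat ahat u) := by
  have e : dir p idx xhat ahat u = fun ω => ∑ j,
      if idx u ω = j then p.direction (xhat u ω) (ahat u ω) j else 0 := by
    funext ω; simp [dir]
  rw [e]
  exact IsFinitelyValued.sum _ fun j _ => IsFinitelyValued.ite (measurableSet_idx_eq hu j)
    (h.isFinitelyValued_direction hu.le j) (IsFinitelyValued.const 0)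

theorem isFinitelyValued_virtual (h : IsAsagaRun p γ τ P idx xhat ahat T) {u t : ℕ} (hu : u ≤ t) :
    IsFinitelyValued (past idx xhat ahat t) (virtual p γ idx xhat ahat u) :=
  (IsFinitelyValued.const p.x0).sub
    ((IsFinitelyValued.sum _ fun w hw => h.isFinitelyValued_dir
      ((Finset.mem_range.1 hw).trans_le hu)).comp (g := fun x => γ • x) (by fun_prop))

theorem isFinitelyValued_gradient (h : IsAsagaRun p γ τ P idx xhat ahat T) {u t : ℕ} (hu : u ≤ t)
    (j : Fin n) : IsFinitelyValued (past idx xhat ahat t) fun ω => gradient (p.f j) (xhat u ω) :=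
  (h.isFinitelyValued_xhat hu).comp (p.continuous_gradient j).measurable

theorem isFinitelyValued_objective (h : IsAsagaRun p γ τ P idx xhat ahat T) {u t : ℕ}
    (hu : u ≤ t) : IsFinitelyValued (past idx xhat ahat t) fun ω => p.objective (xhat u ω) :=
  (h.isFinitelyValued_xhat hu).comp p.continuous_objective.measurable

variable (p P xhat) in
/-- The expected suboptimality of the `t`-th read. -/
noncomputable def gap (t : ℕ) : ℝ := (∫ ω, p.objective (xhat t ω) ∂P) - p.objective p.xstar

variable (p P idx xhat ahat) in
/-- The expected squared norm of the direction of iteration `t`. -/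
noncomputable def dirSq (t : ℕ) : ℝ := ∫ ω, ‖dir p idx xhat ahat t ω‖ ^ 2 ∂P

variable (p γ P idx xhat ahat) in
/-- The expected squared distance of the `t`-th virtual iterate to the minimizer. -/
noncomputable def distSq (t : ℕ) : ℝ := ∫ ω, ‖virtual p γ idx xhat ahat t ω - p.xstar‖ ^ 2 ∂P

variable (p P ahat) in
/-- The expected squared distance of the table read by iteration `t` to the gradients at the
minimizer. -/
noncomputable def memorySq (t : ℕ) : ℝ :=
  ∑ j, ∫ ω, ‖ahat t ω j - gradient (p.f j) p.xstar‖ ^ 2 ∂P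

variable (p P xhat) in
/-- The expected average squared distance of the gradients at the `t`-th read to those at the
minimizer. -/
noncomputable def gradSq (t : ℕ) : ℝ :=
  (n : ℝ)⁻¹ * ∑ j, ∫ ω, ‖gradient (p.f j) (xhat t ω) - gradient (p.f j) p.xstar‖ ^ 2 ∂P

theorem isFinitelyValued_cross (h : IsAsagaRun p γ τ P idx xhat ahat T) {u w t : ℕ} (hu : u < t)
    (hw : w < t) : IsFinitelyValued (past idx xhat ahat t) (cross p idx xhat ahat u w) :=
  IsFinitelyValued.sum _ fun v _ =>
    (((h.isFinitelyValued_dir hu).vec_apply v).comp measurable_abs).mul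
      (((h.isFinitelyValued_dir hw).vec_apply v).comp measurable_abs)

theorem isFinitelyValued_memory (h : IsAsagaRun p γ τ P idx xhat ahat T) {u t : ℕ} (hu : u ≤ t)
    (j : Fin n) : IsFinitelyValued (past idx xhat ahat t)
      fun ω => ‖ahat u ω j - gradient (p.f j) p.xstar‖ ^ 2 :=
  ((h.isFinitelyValued_ahat_apply hu j).sub (IsFinitelyValued.const _)).norm_sq

theorem isFinitelyValued_gradient_sub (h : IsAsagaRun p γ τ P idx xhat ahat T) {u t : ℕ}
    (hu : u ≤ t) (j : Fin n) : IsFinitelyValued (past idx xhat ahat t)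
      fun ω => ‖gradient (p.f j) (xhat u ω) - gradient (p.f j) p.xstar‖ ^ 2 :=
  ((h.isFinitelyValued_gradient hu j).sub (IsFinitelyValued.const _)).norm_sq

variable [IsProbabilityMeasure P]

theorem integral_objective_sub (h : IsAsagaRun p γ τ P idx xhat ahat T) (t : ℕ) :
    ∫ ω, (p.objective (xhat t ω) - p.objective p.xstar) ∂P = gap p P xhat t := by
  rw [integral_sub ((h.isFinitelyValued_objective le_rfl).integrable (h.past_le t))
    (integrable_const _)]
  simp [gap]

theorem gap_nonneg (h : IsAsagaRun p γ τ P idx xhat ahat T) (t : ℕ) : 0 ≤ gap p P xhat t := by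
  rw [← h.integral_objective_sub]
  exact integral_nonneg fun ω => sub_nonneg.2 (p.objective_xstar_le _)

theorem gradSq_le (h : IsAsagaRun p γ τ P idx xhat ahat T) (t : ℕ) :
    gradSq p P xhat t ≤ 2 * p.L * gap p P xhat t := by
  have hn := p.n_cast_pos
  unfold gradSq
  rw [inv_mul_le_iff₀ hn, ← h.integral_objective_sub, ← integral_finsetSum]
  · have e : (n : ℝ) * (2 * p.L * ∫ ω, (p.objective (xhat t ω) - p.objective p.xstar) ∂P)
        = ∫ ω, 2 * p.L * n * (p.objective (xhat t ω) - p.objective p.xstar) ∂P := by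
      rw [integral_const_mul]; ring
    rw [e]
    refine integral_mono ?_ ?_ fun ω => p.sum_norm_sq_gradient_sub_le (xhat t ω)
    · exact (IsFinitelyValued.sum _ fun j _ =>
        h.isFinitelyValued_gradient_sub le_rfl j).integrable (h.past_le t)
    · exact (((h.isFinitelyValued_objective le_rfl).sub
        (IsFinitelyValued.const _)).integrable (h.past_le t)).const_mul _
  · exact fun j _ => (h.isFinitelyValued_gradient_sub le_rfl j).integrable (h.past_le t)

/-- Unbiasedness against any test vector determined by the past, which includes the reads of
iteration t itself. -/
theorem integral_inner_dir (h : IsAsagaRun p γ τ P idx xhat ahat T) (t : ℕ) {Y : Ω → Vec d}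
    (hY : IsFinitelyValued (past idx xhat ahat t) Y) :
    ∫ ω, inner ℝ (dir p idx xhat ahat t ω) (Y ω) ∂P
      = ∫ ω, inner ℝ (p.fullGradient (xhat t ω)) (Y ω) ∂P := by
  have hfv : ∀ j, IsFinitelyValued (past idx xhat ahat t)
      fun ω => inner ℝ (p.direction (xhat t ω) (ahat t ω) j) (Y ω) :=
    fun j => (h.isFinitelyValued_direction le_rfl j).real_inner hY
  have h1 := h.integral_comp_idx t hfv
  rw [← integral_finsetSum _ fun j _ => (hfv j).integrable (h.past_le t),
    ← integral_const_mul] at h1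
  refine h1.trans (integral_congr_ae (Filter.Eventually.of_forall fun ω => ?_))
  simp only [FiniteSumProblem.fullGradient, real_inner_smul_left, ← sum_inner,
    FiniteSumProblem.sum_direction (h.isSupported_ahat t ω)]

theorem dirSq_le (h : IsAsagaRun p γ τ P idx xhat ahat T) (t : ℕ) :
    dirSq p P idx xhat ahat t
      ≤ 2 * gradSq p P xhat t + 2 * ((n : ℝ)⁻¹ * memorySq p P ahat t) := by
  have hn := p.n_cast_pos
  have hle := h.past_le t
  have hfv : ∀ j, IsFinitelyValued (past idx xhat ahat t)
      fun ω => ‖p.direction (xhat t ω) (ahat t ω) j‖ ^ 2 :=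
    fun j => (h.isFinitelyValued_direction le_rfl j).norm_sq
  have hg := fun j => (h.isFinitelyValued_gradient_sub (le_refl t) j).integrable (P := P) hle
  have hm := fun j => (h.isFinitelyValued_memory (le_refl t) j).integrable (P := P) hle
  have h1 := h.integral_comp_idx t hfv
  unfold dirSq gradSq memorySq
  simp only [dir]
  rw [h1, ← integral_finsetSum _ fun j _ => (hfv j).integrable hle,
    ← integral_finsetSum _ fun j _ => hg j, ← integral_finsetSum _ fun j _ => hm j]
  have h2 : ∫ ω, ∑ j, ‖p.direction (xhat t ω) (ahat t ω) j‖ ^ 2 ∂P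
      ≤ ∫ ω, (2 * ∑ j, ‖gradient (p.f j) (xhat t ω) - gradient (p.f j) p.xstar‖ ^ 2
        + 2 * ∑ j, ‖ahat t ω j - gradient (p.f j) p.xstar‖ ^ 2) ∂P :=
    integral_mono (integrable_finsetSum _ fun j _ => (hfv j).integrable hle)
      (((integrable_finsetSum _ fun j _ => hg j).const_mul _).add
        ((integrable_finsetSum _ fun j _ => hm j).const_mul _))
      fun ω => FiniteSumProblem.sum_norm_sq_direction_le (h.isSupported_ahat t ω) (xhat t ω)
  rw [integral_add ((integrable_finsetSum _ fun j _ => hg j).const_mul _)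
    ((integrable_finsetSum _ fun j _ => hm j).const_mul _), integral_const_mul,
    integral_const_mul] at h2
  have h3 := mul_le_mul_of_nonneg_left h2 (inv_nonneg.2 hn.le)
  linarith

/-- Directions of distinct iterations overlap little, by sparsity. -/
theorem integral_cross_le (h : IsAsagaRun p γ τ P idx xhat ahat T) {u t : ℕ} (hut : u < t) :
    ∫ ω, cross p idx xhat ahat u t ω ∂P
      ≤ √p.Delta / 2 * (dirSq p P idx xhat ahat u + dirSq p P idx xhat ahat t) := by
  classical
  have hn := p.n_cast_pos
  set δ := √p.Delta with hδ
  have hδ0 : 0 ≤ δ := Real.sqrt_nonneg _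
  have hδ2 : δ ^ 2 = p.Delta := Real.sq_sqrt p.Delta_nonneg
  have hle := h.past_le (t + 1)
  have hdt := h.isFinitelyValued_dir (Nat.lt_succ_self t)
  have hdu := h.isFinitelyValued_dir (hut.trans (Nat.lt_succ_self t))
  have hcross := (h.isFinitelyValued_cross (hut.trans (Nat.lt_succ_self t))
    (Nat.lt_succ_self t)).integrable (P := P) hle
  have hfv : ∀ j, IsFinitelyValued (past idx xhat ahat t)
      fun ω => ∑ v, if v ∈ p.supp j then dir p idx xhat ahat u ω v ^ 2 else 0 := by
    refine fun j => IsFinitelyValued.sum _ fun v _ => ?_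
    by_cases hv : v ∈ p.supp j
    · simp only [if_pos hv]
      exact ((h.isFinitelyValued_dir hut).vec_apply v).comp (g := fun r : ℝ => r ^ 2)
        (by fun_prop)
    · simp only [if_neg hv]
      exact IsFinitelyValued.const 0
  have hrestr : IsFinitelyValued (past idx xhat ahat (t + 1))
      fun ω => ∑ v, if v ∈ p.supp (idx t ω) then dir p idx xhat ahat u ω v ^ 2 else 0 := by
    have e : (fun ω => ∑ v, if v ∈ p.supp (idx t ω) then dir p idx xhat ahat u ω v ^ 2 else 0)
        = fun ω => ∑ j, if idx t ω = j then
          (∑ v, if v ∈ p.supp j then dir p idx xhat ahat u ω v ^ 2 else 0) else 0 := by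
      funext ω
      simp only [Finset.sum_ite_eq, Finset.mem_univ, if_true]
    rw [e]
    exact IsFinitelyValued.sum _ fun j _ => IsFinitelyValued.ite
      (measurableSet_idx_eq (Nat.lt_succ_self t) j)
      ((hfv j).mono (past_mono (Nat.le_succ t))) (IsFinitelyValued.const 0)
  -- As u < t, the direction of u is known before the index of t is drawn, and each of its
  -- coordinates lies in the random support with probability `degree v / n ≤ Δ`.
  have hR : ∫ ω, (∑ v, if v ∈ p.supp (idx t ω) then dir p idx xhat ahat u ω v ^ 2 else 0) ∂P
      ≤ δ ^ 2 * dirSq p P idx xhat ahat u := by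
    have h1 := h.integral_comp_idx t hfv
    rw [h1, ← integral_finsetSum _ fun j _ => (hfv j).integrable (h.past_le t),
      ← integral_const_mul, dirSq, ← integral_const_mul, hδ2]
    refine integral_mono ?_ ?_ fun ω => ?_
    · exact (integrable_finsetSum _ fun j _ => (hfv j).integrable (h.past_le t)).const_mul _
    · exact (hdu.norm_sq.integrable hle).const_mul _
    · simp only
      rw [Finset.sum_comm, Finset.mul_sum, EuclideanSpace.real_norm_sq_eq, Finset.mul_sum]
      refine Finset.sum_le_sum fun v _ => ?_
      rw [FiniteSumProblem.sum_ite_mem_supp, ← mul_assoc]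
      refine mul_le_mul_of_nonneg_right ?_ (sq_nonneg _)
      rw [inv_mul_eq_div]
      exact p.degree_div_le_Delta v
  have hR' := hrestr.integrable (P := P) hle
  have hcs : ∀ ω v, |dir p idx xhat ahat u ω v| * |dir p idx xhat ahat t ω v|
      = |if v ∈ p.supp (idx t ω) then dir p idx xhat ahat u ω v else 0|
        * |dir p idx xhat ahat t ω v| := by
    intro ω v
    split_ifs with hv
    · rfl
    · rw [h.dir_apply_eq_zero hv]; simp
  have hsq : ∀ ω v, (if v ∈ p.supp (idx t ω) then dir p idx xhat ahat u ω v else 0) ^ 2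
      = if v ∈ p.supp (idx t ω) then dir p idx xhat ahat u ω v ^ 2 else 0 := by
    intro ω v
    split_ifs <;> simp
  rcases hδ0.eq_or_lt with h0 | h0
  -- If Δ = 0, all supports are empty and the directions vanish.
  · have hz : ∀ ω v, dir p idx xhat ahat t ω v = 0 := by
      intro ω v
      by_contra hne
      have hv : v ∈ p.supp (idx t ω) := by
        by_contra hv
        exact hne (h.dir_apply_eq_zero hv)
      have h1 := p.degree_div_le_Delta v
      rw [← hδ2, ← h0, zero_pow two_ne_zero, div_le_iff₀ hn, zero_mul, Nat.cast_nonpos,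
        FiniteSumProblem.degree_eq_card, Finset.card_eq_zero, Finset.filter_eq_empty_iff] at h1
      exact h1 (Finset.mem_univ _) hv
    simp [cross, hz, ← h0]
  -- Young's inequality with weight √Δ, which balances the factor Δ gained in `hR`.
  · have hpt : ∀ ω, cross p idx xhat ahat u t ω ≤ 1 / (2 * δ) *
        (∑ v, if v ∈ p.supp (idx t ω) then dir p idx xhat ahat u ω v ^ 2 else 0)
        + δ / 2 * ‖dir p idx xhat ahat t ω‖ ^ 2 := by
      intro ω
      rw [cross, EuclideanSpace.real_norm_sq_eq, Finset.mul_sum, Finset.mul_sum,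
        ← Finset.sum_add_distrib]
      refine Finset.sum_le_sum fun v _ => ?_
      rw [hcs, ← hsq, ← sq_abs, ← sq_abs (dir p idx xhat ahat t ω v)]
      set a := |if v ∈ p.supp (idx t ω) then dir p idx xhat ahat u ω v else 0|
      set b := |dir p idx xhat ahat t ω v|
      have e : 1 / (2 * δ) * a ^ 2 + δ / 2 * b ^ 2 - a * b = 1 / (2 * δ) * (a - δ * b) ^ 2 := by
        field_simp; ring
      have : 0 ≤ 1 / (2 * δ) * (a - δ * b) ^ 2 := by positivity
      linarith
    calc ∫ ω, cross p idx xhat ahat u t ω ∂P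
        ≤ ∫ ω, (1 / (2 * δ) *
            (∑ v, if v ∈ p.supp (idx t ω) then dir p idx xhat ahat u ω v ^ 2 else 0)
            + δ / 2 * ‖dir p idx xhat ahat t ω‖ ^ 2) ∂P :=
          integral_mono hcross
            ((hR'.const_mul _).add ((hdt.norm_sq.integrable hle).const_mul _)) hpt
      _ = 1 / (2 * δ) *
          ∫ ω, (∑ v, if v ∈ p.supp (idx t ω) then dir p idx xhat ahat u ω v ^ 2 else 0) ∂P
          + δ / 2 * dirSq p P idx xhat ahat t := by
          rw [integral_add (hR'.const_mul _) ((hdt.norm_sq.integrable hle).const_mul _),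
            integral_const_mul, integral_const_mul, dirSq]
      _ ≤ 1 / (2 * δ) * (δ ^ 2 * dirSq p P idx xhat ahat u)
          + δ / 2 * dirSq p P idx xhat ahat t := by gcongr
      _ = _ := by field_simp

end IsAsagaRun

/-! ### The delayed recursions for distance, memory and second moment. -/

namespace IsAsagaRun

variable {n d : ℕ} {Ω : Type*} {p : FiniteSumProblem n d} {γ : ℝ} {τ : ℕ}
  [mΩ : MeasurableSpace Ω] {P : Measure Ω} {idx : ℕ → Ω → Fin n} {xhat : ℕ → Ω → Vec d}
  {ahat : ℕ → Ω → Fin n → Vec d} {T : ℕ → Ω → IterationTimes n d}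

theorem inner_dir_deviation_le (h : IsAsagaRun p γ τ P idx xhat ahat T) (hγ : 0 ≤ γ) (t : ℕ)
    (ω : Ω) : inner ℝ (dir p idx xhat ahat t ω) (xhat t ω - virtual p γ idx xhat ahat t ω)
      ≤ γ * ∑ u ∈ window τ t, cross p idx xhat ahat u t ω := by
  have e : γ * ∑ u ∈ window τ t, cross p idx xhat ahat u t ω
      = ∑ v, (γ * ∑ u ∈ window τ t, |dir p idx xhat ahat u ω v|)
        * |dir p idx xhat ahat t ω v| := by
    simp only [cross]
    rw [Finset.sum_comm, Finset.mul_sum]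
    exact Finset.sum_congr rfl fun v _ => by rw [mul_assoc, Finset.sum_mul]
  rw [e, PiLp.inner_apply]
  refine Finset.sum_le_sum fun v _ => ?_
  refine (le_abs_self _).trans ?_
  simp only [RCLike.inner_apply, conj_trivial, WithLp.ofLp_sub, Pi.sub_apply]
  rw [abs_mul]
  exact mul_le_mul_of_nonneg_right (h.abs_xhat_sub_virtual_le hγ t ω v) (abs_nonneg _)

theorem norm_sq_deviation_le (h : IsAsagaRun p γ τ P idx xhat ahat T) (hγ : 0 ≤ γ) (t : ℕ)
    (ω : Ω) : ‖xhat t ω - virtual p γ idx xhat ahat t ω‖ ^ 2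
      ≤ γ ^ 2 * ∑ u ∈ window τ t, ∑ w ∈ window τ t, cross p idx xhat ahat u w ω := by
  have e : γ ^ 2 * ∑ u ∈ window τ t, ∑ w ∈ window τ t, cross p idx xhat ahat u w ω
      = ∑ v, (γ * ∑ u ∈ window τ t, |dir p idx xhat ahat u ω v|) ^ 2 := by
    simp only [cross, mul_pow]
    rw [← Finset.mul_sum]
    congr 1
    rw [Finset.sum_congr rfl fun u _ => Finset.sum_comm, Finset.sum_comm]
    exact Finset.sum_congr rfl fun v _ => by rw [sq, Finset.sum_mul_sum]
  rw [e, EuclideanSpace.real_norm_sq_eq]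
  refine Finset.sum_le_sum fun v _ => ?_
  rw [← sq_abs]
  exact pow_le_pow_left₀ (abs_nonneg _) (h.abs_xhat_sub_virtual_le hγ t ω v) 2

theorem isFinitelyValued_xhat_sub (h : IsAsagaRun p γ τ P idx xhat ahat T) (t : ℕ) :
    IsFinitelyValued (past idx xhat ahat t) fun ω => xhat t ω - p.xstar :=
  (h.isFinitelyValued_xhat le_rfl).sub (IsFinitelyValued.const _)

theorem isFinitelyValued_deviation (h : IsAsagaRun p γ τ P idx xhat ahat T) (t : ℕ) :
    IsFinitelyValued (past idx xhat ahat t)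
      fun ω => xhat t ω - virtual p γ idx xhat ahat t ω :=
  (h.isFinitelyValued_xhat le_rfl).sub (h.isFinitelyValued_virtual le_rfl)

theorem dirSq_nonneg (t : ℕ) : 0 ≤ dirSq p P idx xhat ahat t :=
  integral_nonneg fun _ => sq_nonneg _

theorem distSq_nonneg (t : ℕ) : 0 ≤ distSq p γ P idx xhat ahat t :=
  integral_nonneg fun _ => sq_nonneg _

open Classical in
/-- The table entry `j` read by iteration `t` consists of gradients computed by iterations `u` with
index `j` that were not overwritten by an iteration that ran entirely in between. -/
theorem norm_sq_ahat_sub_le (h : IsAsagaRun p γ τ P idx xhat ahat T) (t : ℕ) (j : Fin n) (ω : Ω) :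
    ‖ahat t ω j - gradient (p.f j) p.xstar‖ ^ 2 ≤
      (∑ u ∈ Finset.range t, if ω ∈ avoid idx j (u + τ + 1) (t - τ) then
        (if idx u ω = j then ‖gradient (p.f j) (xhat u ω) - gradient (p.f j) p.xstar‖ ^ 2 else 0)
        else 0)
      + if ω ∈ avoid idx j 0 (t - τ) then ‖p.a0 j - gradient (p.f j) p.xstar‖ ^ 2 else 0 := by
  have e : ∀ (A : Prop) [Decidable A] (x : Vec d),
      (if A then ‖x‖ ^ 2 else 0) = ∑ v, if A then x v ^ 2 else 0 := by
    intro A _ x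
    split_ifs
    · rw [EuclideanSpace.real_norm_sq_eq]
    · simp
  simp only [← ite_and]
  simp only [e]
  -- Different coordinates of one table entry may stem from different iterations, so the bound is
  -- proved for each coordinate.
  rw [Finset.sum_comm, ← Finset.sum_add_distrib, EuclideanSpace.real_norm_sq_eq]
  refine Finset.sum_le_sum fun v _ => ?_
  have hnn : ∀ u ∈ Finset.range t, 0 ≤ if ω ∈ avoid idx j (u + τ + 1) (t - τ) ∧ idx u ω = j then
      (gradient (p.f j) (xhat u ω) - gradient (p.f j) p.xstar) v ^ 2 else (0 : ℝ) := fun u _ => by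
    split_ifs <;> positivity
  have hnn' : 0 ≤ if ω ∈ avoid idx j 0 (t - τ) then
      (p.a0 j - gradient (p.f j) p.xstar) v ^ 2 else (0 : ℝ) := by
    split_ifs <;> positivity
  by_cases hv : v ∈ p.supp j
  · rcases h.ahat_cases t ω j v with ⟨hc, hnot⟩ | ⟨u, hut, ⟨huj, -, hur⟩, hmax, hc⟩
    · have hav : ω ∈ avoid idx j 0 (t - τ) := by
        intro w hw hwj
        rw [Finset.mem_Ico] at hw
        exact hnot w (by omega) ⟨hwj, hv, h.writeA_lt_readA (by omega) j (hwj ▸ hv)⟩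
      rw [if_pos hav]
      refine le_add_of_nonneg_of_le (Finset.sum_nonneg hnn) (le_of_eq ?_)
      simp [hc]
    -- An iteration w of index j with u + τ < w < t - τ starts after u has finished and finishes
    -- before t starts; its write would have replaced that of u. Losing τ labels at each end
    -- produces the delay 2τ.
    · have hav : ω ∈ avoid idx j (u + τ + 1) (t - τ) := by
        intro w hw hwj
        rw [Finset.mem_Ico] at hw
        have h1 := hmax w (by omega) hwj (h.writeA_lt_readA (by omega) j (hwj ▸ hv))
        exact absurd (h.writeA_lt_writeA (by omega) (huj ▸ hv) (hwj ▸ hv)) (not_lt.2 h1)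
      refine le_add_of_le_of_nonneg ?_ hnn'
      refine le_trans (le_of_eq ?_) (Finset.single_le_sum hnn (Finset.mem_range.2 hut))
      rw [if_pos ⟨hav, huj⟩]
      simp [hc]
  · have : (ahat t ω j - gradient (p.f j) p.xstar) v = 0 := by
      simp [h.isSupported_ahat t ω j v hv, FiniteSumProblem.gradient_apply_eq_zero hv]
    rw [this]
    have := add_nonneg (Finset.sum_nonneg hnn) hnn'
    simpa using this

variable [IsProbabilityMeasure P]

theorem distSq_zero (h : IsAsagaRun p γ τ P idx xhat ahat T) :
    distSq p γ P idx xhat ahat 0 = ‖p.x0 - p.xstar‖ ^ 2 := by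
  have := h.past_le 0
  simp [distSq, virtual]

theorem integrable_cross (h : IsAsagaRun p γ τ P idx xhat ahat T) (u w : ℕ) :
    Integrable (cross p idx xhat ahat u w) P :=
  (h.isFinitelyValued_cross (t := max u w + 1) (by omega) (by omega)).integrable
    (h.past_le _)

theorem integral_inner_dir_ge (h : IsAsagaRun p γ τ P idx xhat ahat T) (t : ℕ) :
    gap p P xhat t + p.mu / 2 * ∫ ω, ‖xhat t ω - p.xstar‖ ^ 2 ∂P
      ≤ ∫ ω, inner ℝ (dir p idx xhat ahat t ω) (xhat t ω - p.xstar) ∂P := by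
  have hle := h.past_le t
  have hx := h.isFinitelyValued_xhat_sub t
  have hobj := ((h.isFinitelyValued_objective (le_refl t)).sub
    (IsFinitelyValued.const (p.objective p.xstar))).integrable (P := P) hle
  have hsq := (hx.norm_sq.integrable (P := P) hle).const_mul (p.mu / 2)
  rw [h.integral_inner_dir t hx, ← h.integral_objective_sub, ← integral_const_mul,
    ← integral_add hobj hsq]
  have hfull : IsFinitelyValued (past idx xhat ahat t) fun ω => p.fullGradient (xhat t ω) :=
    (IsFinitelyValued.sum _ fun j _ => h.isFinitelyValued_gradient le_rfl j).comp
      (g := fun x => (n : ℝ)⁻¹ • x) (by fun_prop)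
  exact integral_mono (hobj.add hsq) ((hfull.real_inner hx).integrable hle)
    fun ω => p.objective_add_norm_sq_le_inner (xhat t ω)

/-- Expand the square, then replace the virtual iterate in the inner product by the read, at the
cost of overlaps with the window. -/
theorem distSq_succ_le (h : IsAsagaRun p γ τ P idx xhat ahat T) (hγ : 0 ≤ γ) (t : ℕ) :
    distSq p γ P idx xhat ahat (t + 1) ≤ distSq p γ P idx xhat ahat t
      - 2 * γ * gap p P xhat t - γ * p.mu * ∫ ω, ‖xhat t ω - p.xstar‖ ^ 2 ∂P
      + γ ^ 2 * dirSq p P idx xhat ahat t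
      + 2 * γ ^ 2 * ∑ u ∈ window τ t, ∫ ω, cross p idx xhat ahat u t ω ∂P := by
  have hle := h.past_le (t + 1)
  have hdt := h.isFinitelyValued_dir (Nat.lt_succ_self t)
  have hv := fun (u : ℕ) (hu : u ≤ t + 1) =>
    (((h.isFinitelyValued_virtual hu).sub (IsFinitelyValued.const p.xstar)).norm_sq).integrable
      (P := P) hle
  have hin := (hdt.real_inner ((h.isFinitelyValued_xhat_sub t).mono
    (past_mono (Nat.le_succ t)))).integrable (P := P) hle
  have hsq := hdt.norm_sq.integrable (P := P) hle
  have hcr := integrable_finsetSum (window τ t) fun u _ => h.integrable_cross u t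
  have hpt : ∀ ω, ‖virtual p γ idx xhat ahat (t + 1) ω - p.xstar‖ ^ 2
      ≤ ‖virtual p γ idx xhat ahat t ω - p.xstar‖ ^ 2
        - 2 * γ * inner ℝ (dir p idx xhat ahat t ω) (xhat t ω - p.xstar)
        + γ ^ 2 * ‖dir p idx xhat ahat t ω‖ ^ 2
        + 2 * γ ^ 2 * ∑ u ∈ window τ t, cross p idx xhat ahat u t ω := by
    intro ω
    set g := dir p idx xhat ahat t ω with hg
    set y := virtual p γ idx xhat ahat t ω with hy
    have e1 : virtual p γ idx xhat ahat (t + 1) ω - p.xstar = (y - p.xstar) - γ • g := by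
      simp only [virtual, Finset.sum_range_succ, smul_add, hy, hg]
      abel
    have e2 : y - p.xstar = (xhat t ω - p.xstar) - (xhat t ω - y) := by abel
    have e3 : inner ℝ g (y - p.xstar)
        = inner ℝ g (xhat t ω - p.xstar) - inner ℝ g (xhat t ω - y) := by
      rw [← inner_sub_right, ← e2]
    have h1 := h.inner_dir_deviation_le hγ t ω
    have h2 := mul_le_mul_of_nonneg_left h1 hγ
    rw [e1, norm_sub_sq_real, real_inner_smul_right, real_inner_comm, e3, norm_smul, mul_pow,
      Real.norm_eq_abs, sq_abs]
    linarith
  have hint := integral_mono (hv (t + 1) le_rfl)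
    ((((hv t (Nat.le_succ t)).sub (hin.const_mul (2 * γ))).add (hsq.const_mul (γ ^ 2))).add
      (hcr.const_mul (2 * γ ^ 2))) hpt
  have hsub := (hv t (Nat.le_succ t)).sub (hin.const_mul (2 * γ))
  have hadd := hsub.add (hsq.const_mul (γ ^ 2))
  have e4 := integral_add' hadd (hcr.const_mul (2 * γ ^ 2))
  rw [integral_add' hsub (hsq.const_mul (γ ^ 2)),
    integral_sub' (hv t (Nat.le_succ t)) (hin.const_mul (2 * γ)), integral_const_mul,
    integral_const_mul, integral_const_mul,
    integral_finsetSum _ fun u _ => h.integrable_cross u t] at e4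
  have hfin := hint.trans_eq e4
  have h3 := mul_le_mul_of_nonneg_left (h.integral_inner_dir_ge t) hγ
  unfold distSq dirSq
  linarith

/-- Expanding the square over the window, the diagonal contributes the second moments, and the
off-diagonal overlaps cost a further factor τ√Δ. -/
theorem integral_norm_sq_deviation_le (h : IsAsagaRun p γ τ P idx xhat ahat T) (hγ : 0 ≤ γ)
    (t : ℕ) : ∫ ω, ‖xhat t ω - virtual p γ idx xhat ahat t ω‖ ^ 2 ∂P
      ≤ γ ^ 2 * ((1 + τ * √p.Delta) * ∑ u ∈ window τ t, dirSq p P idx xhat ahat u) := by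
  set δ := √p.Delta with hδ
  have hδ0 : 0 ≤ δ := Real.sqrt_nonneg _
  set G := dirSq p P idx xhat ahat with hG
  have hG0 : ∀ u, 0 ≤ G u := fun u => dirSq_nonneg u
  have hle : ∀ u w, ∫ ω, cross p idx xhat ahat u w ω ∂P
      ≤ (if u = w then G u else 0) + δ / 2 * (G u + G w) := by
    intro u w
    have h0 : 0 ≤ δ / 2 * (G u + G w) := mul_nonneg (by positivity) (add_nonneg (hG0 u) (hG0 w))
    rcases lt_trichotomy u w with huw | huw | huw
    · rw [if_neg huw.ne, zero_add]
      exact h.integral_cross_le huw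
    · subst huw
      rw [if_pos rfl]
      simp only [cross_self]
      exact le_add_of_nonneg_right h0
    · rw [if_neg huw.ne', zero_add, add_comm]
      simp only [cross_comm u w]
      exact h.integral_cross_le huw
  have h1 := integral_mono
    ((h.isFinitelyValued_deviation t).norm_sq.integrable (P := P) (h.past_le t))
    ((integrable_finsetSum (window τ t) fun u _ =>
      integrable_finsetSum (window τ t) fun w _ => h.integrable_cross u w).const_mul (γ ^ 2))
    (h.norm_sq_deviation_le hγ t)
  refine h1.trans ?_
  rw [integral_const_mul]
  refine mul_le_mul_of_nonneg_left ?_ (sq_nonneg γ)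
  rw [integral_finsetSum _ fun u _ =>
    integrable_finsetSum (window τ t) fun w _ => h.integrable_cross u w]
  have e : ∀ u, ∫ ω, ∑ w ∈ window τ t, cross p idx xhat ahat u w ω ∂P
      = ∑ w ∈ window τ t, ∫ ω, cross p idx xhat ahat u w ω ∂P := fun u =>
    integral_finsetSum _ fun w _ => h.integrable_cross u w
  simp only [e]
  have hS : 0 ≤ ∑ u ∈ window τ t, G u := Finset.sum_nonneg fun u _ => hG0 u
  have hcard : ((window τ t).card : ℝ) ≤ τ := Nat.cast_le.2 (card_window_le t)
  calc ∑ u ∈ window τ t, ∑ w ∈ window τ t, ∫ ω, cross p idx xhat ahat u w ω ∂P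
      ≤ ∑ u ∈ window τ t, ∑ w ∈ window τ t,
          ((if u = w then G u else 0) + δ / 2 * (G u + G w)) :=
        Finset.sum_le_sum fun u _ => Finset.sum_le_sum fun w _ => hle u w
    _ = ∑ u ∈ window τ t, G u + δ * (window τ t).card * ∑ u ∈ window τ t, G u := by
        simp only [Finset.sum_add_distrib, Finset.sum_ite_eq, ← Finset.mul_sum, Finset.sum_const,
          nsmul_eq_mul]
        rw [Finset.sum_congr rfl fun u (hu : u ∈ window τ t) => if_pos hu]
        ring
    _ ≤ ∑ u ∈ window τ t, G u + δ * τ * ∑ u ∈ window τ t, G u := by gcongr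
    _ = _ := by ring

/-- The delayed recursion for the squared distance of the virtual iterates. -/
theorem distSq_recursion (h : IsAsagaRun p γ τ P idx xhat ahat T) (hγ : 0 ≤ γ) {ρ : ℝ}
    (hρ0 : 0 ≤ ρ) (hρ : 2 * ρ ≤ γ * p.mu) (t : ℕ) :
    distSq p γ P idx xhat ahat (t + 1) ≤ (1 - ρ) * distSq p γ P idx xhat ahat t
      + γ ^ 2 * (1 + τ * √p.Delta) * dirSq p P idx xhat ahat t
      + γ ^ 2 * (√p.Delta + 2 * ρ * (1 + τ * √p.Delta))
        * (∑ u ∈ Finset.range t, if t ≤ u + τ then dirSq p P idx xhat ahat u else 0)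
      - 2 * γ * gap p P xhat t := by
  rw [← Finset.sum_filter, ← window]
  set δ := √p.Delta with hδ
  have hδ0 : 0 ≤ δ := Real.sqrt_nonneg _
  have hG0 : ∀ u, 0 ≤ dirSq p P idx xhat ahat u := fun u => dirSq_nonneg u
  have h1 := h.distSq_succ_le hγ t
  have h2 := mul_le_mul_of_nonneg_left (h.integral_norm_sq_deviation_le hγ t) hρ0
  have hcard : ((window τ t).card : ℝ) ≤ τ := Nat.cast_le.2 (card_window_le t)
  have h3 : ∑ u ∈ window τ t, ∫ ω, cross p idx xhat ahat u t ω ∂P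
      ≤ δ / 2 * (∑ u ∈ window τ t, dirSq p P idx xhat ahat u)
        + δ / 2 * (τ * dirSq p P idx xhat ahat t) := by
    calc ∑ u ∈ window τ t, ∫ ω, cross p idx xhat ahat u t ω ∂P
        ≤ ∑ u ∈ window τ t, δ / 2 * (dirSq p P idx xhat ahat u + dirSq p P idx xhat ahat t) :=
          Finset.sum_le_sum fun u hu => h.integral_cross_le (mem_window.1 hu).1
      _ = δ / 2 * (∑ u ∈ window τ t, dirSq p P idx xhat ahat u)
          + δ / 2 * ((window τ t).card * dirSq p P idx xhat ahat t) := by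
          rw [← Finset.mul_sum, Finset.sum_add_distrib, Finset.sum_const, nsmul_eq_mul, mul_add]
      _ ≤ _ := by have := hG0 t; gcongr
  have h4 := mul_le_mul_of_nonneg_left h3 (by positivity : 0 ≤ 2 * γ ^ 2)
  have hx := (h.isFinitelyValued_xhat_sub t).norm_sq.integrable (P := P) (h.past_le t)
  have hdev := (h.isFinitelyValued_deviation t).norm_sq.integrable (P := P) (h.past_le t)
  have hvirt := ((h.isFinitelyValued_virtual (le_refl t)).sub
    (IsFinitelyValued.const p.xstar)).norm_sq.integrable (P := P) (h.past_le t)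
  -- Strong convexity contracts the distance of the read; passing to the virtual iterate halves the
  -- rate, hence 2ρ ≤ γμ, and adds 2ρ times the squared deviation.
  have h5 : distSq p γ P idx xhat ahat t ≤ 2 * ∫ ω, ‖xhat t ω - p.xstar‖ ^ 2 ∂P
      + 2 * ∫ ω, ‖xhat t ω - virtual p γ idx xhat ahat t ω‖ ^ 2 ∂P := by
    rw [distSq, ← integral_const_mul, ← integral_const_mul,
      ← integral_add (hx.const_mul 2) (hdev.const_mul 2)]
    refine integral_mono hvirt ((hx.const_mul 2).add (hdev.const_mul 2)) fun ω => ?_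
    have e : virtual p γ idx xhat ahat t ω - p.xstar
        = (xhat t ω - p.xstar) - (xhat t ω - virtual p γ idx xhat ahat t ω) := by abel
    simp only
    rw [e]
    have := parallelogram_law_with_norm ℝ (xhat t ω - p.xstar)
      (xhat t ω - virtual p γ idx xhat ahat t ω)
    nlinarith [sq_nonneg ‖(xhat t ω - p.xstar) + (xhat t ω - virtual p γ idx xhat ahat t ω)‖]
  have h6 := mul_le_mul_of_nonneg_left h5 hρ0
  have hX : 0 ≤ ∫ ω, ‖xhat t ω - p.xstar‖ ^ 2 ∂P := integral_nonneg fun _ => sq_nonneg _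
  have h7 := mul_le_mul_of_nonneg_right hρ hX
  linarith

/-- In expectation, the event that u samples j contributes 1/n, which turns the sum over j into
`gradSq`, and the independent avoidance of j contributes the power of 1 - 1/n. -/
theorem memorySq_le (h : IsAsagaRun p γ τ P idx xhat ahat T) (t : ℕ) :
    memorySq p P ahat t ≤
      (∑ u ∈ Finset.range t, (1 - 1 / (n : ℝ)) ^ (t - u - 1 - 2 * τ) * gradSq p P xhat u)
      + (1 - 1 / (n : ℝ)) ^ (t - τ) * ∑ j, ‖p.a0 j - gradient (p.f j) p.xstar‖ ^ 2 := by
  classical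
  have hfv : ∀ j u, IsFinitelyValued (past idx xhat ahat (u + τ + 1)) fun ω =>
      if idx u ω = j then ‖gradient (p.f j) (xhat u ω) - gradient (p.f j) p.xstar‖ ^ 2 else 0 :=
    fun j u => IsFinitelyValued.ite (measurableSet_idx_eq (by omega) j)
      (h.isFinitelyValued_gradient_sub (by omega) j) (IsFinitelyValued.const 0)
  have hav : ∀ {a : ℕ} (b : ℕ) (j : Fin n) {X : Ω → ℝ},
      IsFinitelyValued (past idx xhat ahat a) X →
      Integrable (fun ω => if ω ∈ avoid idx j a b then X ω else 0) P := by
    intro a b j X hX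
    rcases le_or_gt a b with hab | hab
    · exact (isFinitelyValued_ite_avoid j hab hX).integrable (h.past_le b)
    · have : ∀ ω, ω ∈ avoid idx j a b := fun ω => by simp [avoid, Finset.Ico_eq_empty_of_le hab.le]
      simp only [this, if_true]
      exact hX.integrable (h.past_le a)
  have hj : ∀ j, ∫ ω, ‖ahat t ω j - gradient (p.f j) p.xstar‖ ^ 2 ∂P ≤
      (∑ u ∈ Finset.range t, (1 - 1 / (n : ℝ)) ^ (t - u - 1 - 2 * τ) * ((n : ℝ)⁻¹ *
        ∫ ω, ‖gradient (p.f j) (xhat u ω) - gradient (p.f j) p.xstar‖ ^ 2 ∂P))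
      + (1 - 1 / (n : ℝ)) ^ (t - τ) * ‖p.a0 j - gradient (p.f j) p.xstar‖ ^ 2 := by
    intro j
    have hsum := integrable_finsetSum (Finset.range t) fun u _ => hav (t - τ) j (hfv j u)
    have hconst : IsFinitelyValued (past idx xhat ahat 0)
      fun _ : Ω => ‖p.a0 j - gradient (p.f j) p.xstar‖ ^ 2 := IsFinitelyValued.const _
    have h1 := integral_mono
      ((h.isFinitelyValued_memory (le_refl t) j).integrable (P := P) (h.past_le t))
      (hsum.add (hav (t - τ) j hconst)) (h.norm_sq_ahat_sub_le t j)
    refine h1.trans (le_of_eq ?_)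
    simp only [Pi.add_apply]
    rw [integral_add hsum (hav (t - τ) j hconst),
      integral_finsetSum _ fun u _ => hav (t - τ) j (hfv j u)]
    congr 1
    · refine Finset.sum_congr rfl fun u _ => ?_
      rw [h.integral_ite_avoid j (hfv j u),
        h.integral_ite_idx u j (h.isFinitelyValued_gradient_sub le_rfl j)]
      congr 2
      omega
    · rw [h.integral_ite_avoid j hconst]
      simp
  refine (Finset.sum_le_sum fun j _ => hj j).trans (le_of_eq ?_)
  rw [Finset.sum_add_distrib, Finset.sum_comm, ← Finset.mul_sum]
  simp only [gradSq, ← Finset.mul_sum]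

/-- The expected squared norm of a direction is controlled by the suboptimality of past reads. -/
theorem dirSq_recursion (h : IsAsagaRun p γ τ P idx xhat ahat T) (t : ℕ) :
    dirSq p P idx xhat ahat t ≤ 4 * p.L * gap p P xhat t
      + 4 * p.L / n *
        ∑ u ∈ Finset.range t, (1 - 1 / (n : ℝ)) ^ (t - u - 1 - 2 * τ) * gap p P xhat u
      + 2 * (1 - 1 / (n : ℝ)) ^ (t - τ) *
        ((n : ℝ)⁻¹ * ∑ j, ‖p.a0 j - gradient (p.f j) p.xstar‖ ^ 2) := by
  have hn := p.n_cast_pos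
  have hβ : 0 ≤ 1 - 1 / (n : ℝ) := sub_nonneg.2 ((div_le_one hn).2 p.one_le_n_cast)
  have h1 := h.dirSq_le t
  have h2 := h.gradSq_le t
  have h3 : ∑ u ∈ Finset.range t, (1 - 1 / (n : ℝ)) ^ (t - u - 1 - 2 * τ) * gradSq p P xhat u
      ≤ 2 * p.L *
        ∑ u ∈ Finset.range t, (1 - 1 / (n : ℝ)) ^ (t - u - 1 - 2 * τ) * gap p P xhat u := by
    rw [Finset.mul_sum]
    refine Finset.sum_le_sum fun u _ => ?_
    have := mul_le_mul_of_nonneg_left (h.gradSq_le u)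
      (pow_nonneg hβ (t - u - 1 - 2 * τ))
    linarith
  have h4 := mul_le_mul_of_nonneg_left ((h.memorySq_le t).trans (add_le_add_left h3 _))
    (inv_nonneg.2 hn.le)
  rw [mul_add] at h4
  have e : 4 * p.L / n = 2 * ((n : ℝ)⁻¹ * (2 * p.L)) := by ring
  rw [e]
  linarith

/-- Geometric convergence of Asaga for all small enough rates and step sizes. -/
theorem geometric_gap (h : IsAsagaRun p γ τ P idx xhat ahat T) (hγ : 0 < γ) {ρ : ℝ}
    (hρ0 : 0 ≤ ρ) (hρ : 2 * ρ ≤ γ * p.mu) (hτρ : (2 * τ + 1) * ρ ≤ 1 / 10)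
    (hnρ : n * ρ ≤ 1 / 10)
    (hstep : 81 * (γ * p.L * (1 + τ * √p.Delta) * (1 + τ / n)) ≤ 4) (t : ℕ) :
    γ * gap p P xhat t ≤ (1 - ρ) ^ t * p.initialError := by
  have hn := p.n_cast_pos
  have h1 := geometric_of_delayed_recursion (e := gap p P xhat)
    (A := distSq p γ P idx xhat ahat) (G := dirSq p P idx xhat ahat)
    (h0 := (n : ℝ)⁻¹ * ∑ j, ‖p.a0 j - gradient (p.f j) p.xstar‖ ^ 2)
    p.n_pos hγ hρ0 p.L_pos (Real.sqrt_nonneg p.Delta) (by positivity) h.gap_nonneg distSq_nonneg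
    dirSq_nonneg hτρ hnρ hstep (h.distSq_recursion hγ.le hρ0 hρ) h.dirSq_recursion t
  rwa [h.distSq_zero, mul_inv_cancel_left₀ hn.ne'] at h1

end IsAsagaRun

namespace IsAsagaRun

/-! ### The sequential baseline. -/

section Sequential

variable {n d : ℕ} {Ω : Type*} {p : FiniteSumProblem n d} {γ : ℝ}
  [mΩ : MeasurableSpace Ω] {P : Measure Ω} {idx : ℕ → Ω → Fin n} {xhat : ℕ → Ω → Vec d}
  {ahat : ℕ → Ω → Fin n → Vec d} {T : ℕ → Ω → IterationTimes n d}

theorem window_zero (t : ℕ) : window 0 t = ∅ := by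
  refine Finset.eq_empty_of_forall_notMem fun u hu => ?_
  rw [mem_window] at hu
  omega

theorem xhat_eq_virtual (h : IsAsagaRun p γ 0 P idx xhat ahat T) (hγ : 0 ≤ γ) (t : ℕ) (ω : Ω) :
    xhat t ω = virtual p γ idx xhat ahat t ω := by
  ext v
  have h1 := h.abs_xhat_sub_virtual_le hγ t ω v
  rw [window_zero, Finset.sum_empty, mul_zero] at h1
  exact sub_eq_zero.1 (abs_nonpos_iff.1 h1)

theorem ahat_zero {τ : ℕ} (h : IsAsagaRun p γ τ P idx xhat ahat T) (ω : Ω) :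
    ahat 0 ω = p.a0 := by
  ext j v
  exact h.ahat_init 0 ω j v fun u hu => absurd hu (Nat.not_lt_zero u)

/-- Without overlaps, the last write in time is the one with the largest label. -/
theorem ahat_eq_of_last (h : IsAsagaRun p γ 0 P idx xhat ahat T) {t u : ℕ} {ω : Ω} {j : Fin n}
    {v : Fin d} (hv : v ∈ p.supp j) (hut : u < t) (huj : idx u ω = j)
    (hlast : ∀ w < t, idx w ω = j → w ≤ u) :
    ahat t ω j v = gradient (p.f j) (xhat u ω) v := by
  refine h.ahat_last t ω j v u hut huj hv (h.writeA_lt_readA (by omega) j (huj ▸ hv)) ?_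
  intro w hwt hwj _
  rcases (hlast w hwt hwj).eq_or_lt with rfl | hwu
  · exact le_rfl
  · exact (h.writeA_lt_writeA (by omega) (hwj ▸ hv) (huj ▸ hv)).le

/-- Without overlap all coordinates of a table entry come from the same iteration, so the table
evolves exactly as in Saga. -/
theorem ahat_succ (h : IsAsagaRun p γ 0 P idx xhat ahat T) (t : ℕ) (ω : Ω) (j : Fin n) :
    ahat (t + 1) ω j = if idx t ω = j then gradient (p.f j) (xhat t ω) else ahat t ω j := by
  classical
  ext v
  by_cases hv : v ∈ p.supp j
  · split_ifs with hj
    · exact h.ahat_eq_of_last hv (Nat.lt_succ_self t) hj fun w hw _ => Nat.lt_succ_iff.1 hw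
    · let s := (Finset.range t).filter fun u => idx u ω = j
      have hlt : ∀ w < t + 1, idx w ω = j → w < t := fun w hw hwj =>
        lt_of_le_of_ne (Nat.lt_succ_iff.1 hw) (by rintro rfl; exact hj hwj)
      rcases s.eq_empty_or_nonempty with hs | hs
      · have hs' : ∀ u < t, idx u ω ≠ j := fun u hu =>
          Finset.filter_eq_empty_iff.1 hs (Finset.mem_range.2 hu)
        rw [h.ahat_init t ω j v fun u hu huj => hs' u hu huj.1,
          h.ahat_init (t + 1) ω j v fun u hu huj => hs' u (hlt u hu huj.1) huj.1]
      · obtain ⟨u, hu, hmax⟩ := s.exists_max_image id hs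
        obtain ⟨hut, huj⟩ := Finset.mem_filter.1 hu
        rw [Finset.mem_range] at hut
        have hlast : ∀ w < t, idx w ω = j → w ≤ u := fun w hw hwj =>
          hmax w (Finset.mem_filter.2 ⟨Finset.mem_range.2 hw, hwj⟩)
        rw [h.ahat_eq_of_last hv hut huj hlast,
          h.ahat_eq_of_last hv (hut.trans (Nat.lt_succ_self t)) huj fun w hw hwj =>
            hlast w (hlt w hw hwj) hwj]
  · rw [h.isSupported_ahat (t + 1) ω j v hv]
    split_ifs
    · rw [FiniteSumProblem.gradient_apply_eq_zero hv]
    · rw [h.isSupported_ahat t ω j v hv]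

variable [IsProbabilityMeasure P]

theorem memorySq_zero {τ : ℕ} (h : IsAsagaRun p γ τ P idx xhat ahat T) :
    memorySq p P ahat 0 = ∑ j, ‖p.a0 j - gradient (p.f j) p.xstar‖ ^ 2 := by
  simp [memorySq, h.ahat_zero]

theorem memorySq_succ (h : IsAsagaRun p γ 0 P idx xhat ahat T) (t : ℕ) :
    memorySq p P ahat (t + 1) = (1 - 1 / (n : ℝ)) * memorySq p P ahat t + gradSq p P xhat t := by
  have hj : ∀ j, ∫ ω, ‖ahat (t + 1) ω j - gradient (p.f j) p.xstar‖ ^ 2 ∂P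
      = (1 - 1 / (n : ℝ)) * ∫ ω, ‖ahat t ω j - gradient (p.f j) p.xstar‖ ^ 2 ∂P
        + (n : ℝ)⁻¹ * ∫ ω, ‖gradient (p.f j) (xhat t ω) - gradient (p.f j) p.xstar‖ ^ 2 ∂P := by
    intro j
    have hN := h.isFinitelyValued_memory (le_refl t) j
    have hD := h.isFinitelyValued_gradient_sub (le_refl t) j
    have hite : ∀ {X : Ω → ℝ}, IsFinitelyValued (past idx xhat ahat t) X →
        Integrable (fun ω => if idx t ω = j then X ω else 0) P := fun hX =>
      (IsFinitelyValued.ite (measurableSet_idx_eq (Nat.lt_succ_self t) j)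
        (hX.mono (past_mono (Nat.le_succ t))) (IsFinitelyValued.const 0)).integrable
          (h.past_le (t + 1))
    have e : ∀ ω, ‖ahat (t + 1) ω j - gradient (p.f j) p.xstar‖ ^ 2
        = (‖ahat t ω j - gradient (p.f j) p.xstar‖ ^ 2
            - if idx t ω = j then ‖ahat t ω j - gradient (p.f j) p.xstar‖ ^ 2 else 0)
          + if idx t ω = j then ‖gradient (p.f j) (xhat t ω) - gradient (p.f j) p.xstar‖ ^ 2
            else 0 := by
      intro ω
      rw [h.ahat_succ]
      split_ifs <;> ring
    have hNi := hN.integrable (P := P) (h.past_le t)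
    have e' := integral_add' (hNi.sub (hite hN)) (hite hD)
    rw [integral_sub' hNi (hite hN), h.integral_ite_idx t j hN, h.integral_ite_idx t j hD] at e'
    refine ((integral_congr_ae (Filter.Eventually.of_forall e)).trans e').trans ?_
    ring
  simp only [memorySq, hj, gradSq, Finset.sum_add_distrib, ← Finset.mul_sum]

/-- In the Lyapunov function the weight 3/(25L²) is tuned: the gradient terms cost (2 + 3)/(25L²) =
1/(5L²), which by cocoercivity the decrease 2γe pays exactly, and of the memory decay 3/(25L²n) the
direction uses only 2/(25L²n). -/
theorem sequential_step (h : IsAsagaRun p (1 / (5 * p.L)) 0 P idx xhat ahat T) (t : ℕ) :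
    distSq p (1 / (5 * p.L)) P idx xhat ahat (t + 1)
        + 3 / (25 * p.L ^ 2) * memorySq p P ahat (t + 1)
      ≤ (1 - p.sagaRate) * (distSq p (1 / (5 * p.L)) P idx xhat ahat t
        + 3 / (25 * p.L ^ 2) * memorySq p P ahat t) := by
  have hL := p.L_pos
  have hn := p.n_cast_pos
  have hmu := p.mu_pos
  have hγ : 0 ≤ 1 / (5 * p.L) := by positivity
  have hraten : p.sagaRate ≤ 1 / 5 * (1 / n) := by
    unfold FiniteSumProblem.sagaRate
    gcongr
    exact min_le_left _ _
  have hrateκ : p.sagaRate ≤ 1 / (5 * p.L) * p.mu := by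
    have : 1 / (5 * p.L) * p.mu = 1 / 5 * (1 / p.kappa) := by
      unfold FiniteSumProblem.kappa; field_simp
    rw [this]
    unfold FiniteSumProblem.sagaRate
    gcongr
    exact min_le_right _ _
  have hA : 0 ≤ distSq p (1 / (5 * p.L)) P idx xhat ahat t := distSq_nonneg t
  have hM : 0 ≤ memorySq p P ahat t :=
    Finset.sum_nonneg fun j _ => integral_nonneg fun _ => sq_nonneg _
  have h1 := h.distSq_succ_le hγ t
  have hx : ∫ ω, ‖xhat t ω - p.xstar‖ ^ 2 ∂P = distSq p (1 / (5 * p.L)) P idx xhat ahat t := by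
    simp only [distSq, h.xhat_eq_virtual hγ]
  rw [hx, window_zero, Finset.sum_empty, mul_zero, add_zero] at h1
  have h2 := mul_le_mul_of_nonneg_left (h.dirSq_le t) (sq_nonneg (1 / (5 * p.L)))
  have h3 := h.gradSq_le t
  rw [h.memorySq_succ]
  generalize distSq p (1 / (5 * p.L)) P idx xhat ahat t = A at *
  generalize distSq p (1 / (5 * p.L)) P idx xhat ahat (t + 1) = A' at *
  generalize dirSq p P idx xhat ahat t = G at *
  generalize memorySq p P ahat t = M at *
  generalize gradSq p P xhat t = D at *
  generalize gap p P xhat t = e at *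
  generalize p.sagaRate = ρ at *
  have e1 : (1 / (5 * p.L)) ^ 2 * (2 * D + 2 * ((n : ℝ)⁻¹ * M))
      = 2 / (25 * p.L ^ 2) * D + 2 / (25 * p.L ^ 2) * ((n : ℝ)⁻¹ * M) := by
    field_simp
    ring
  have h4 := mul_le_mul_of_nonneg_left h3 (by positivity : 0 ≤ 1 / (5 * p.L ^ 2))
  have e2 : 1 / (5 * p.L ^ 2) * (2 * p.L * e) = 2 * (1 / (5 * p.L)) * e := by field_simp
  have e3 : 1 / (5 * p.L ^ 2) * D = 2 / (25 * p.L ^ 2) * D + 3 / (25 * p.L ^ 2) * D := by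
    field_simp; ring
  have h5 : ρ * (3 / (25 * p.L ^ 2) * M)
      ≤ 3 / (25 * p.L ^ 2) * ((n : ℝ)⁻¹ * M) - 2 / (25 * p.L ^ 2) * ((n : ℝ)⁻¹ * M) := by
    have hcM : 0 ≤ 3 / (25 * p.L ^ 2) * M := by positivity
    have h6 := mul_le_mul_of_nonneg_right hraten hcM
    have e4 : 1 / 5 * (1 / (n : ℝ)) * (3 / (25 * p.L ^ 2) * M)
        = 3 / 5 * (1 / (25 * p.L ^ 2) * ((n : ℝ)⁻¹ * M)) := by ring
    have e5 : 3 / (25 * p.L ^ 2) * ((n : ℝ)⁻¹ * M) - 2 / (25 * p.L ^ 2) * ((n : ℝ)⁻¹ * M)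
        = 1 / (25 * p.L ^ 2) * ((n : ℝ)⁻¹ * M) := by ring
    have h7 : 0 ≤ 1 / (25 * p.L ^ 2) * ((n : ℝ)⁻¹ * M) := by positivity
    rw [e5]
    linarith
  have h8 := mul_le_mul_of_nonneg_right hrateκ hA
  have e6 : 3 / (25 * p.L ^ 2) * ((1 - 1 / (n : ℝ)) * M + D)
      = 3 / (25 * p.L ^ 2) * M - 3 / (25 * p.L ^ 2) * ((n : ℝ)⁻¹ * M)
        + 3 / (25 * p.L ^ 2) * D := by ring
  rw [e6]
  linarith

/-- Sequential Sparse Saga with step size `1 / (5 L)`. -/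
theorem sequential_convergence (h : IsAsagaRun p (1 / (5 * p.L)) 0 P idx xhat ahat T) (t : ℕ) :
    Integrable (fun ω => ‖xhat t ω - p.xstar‖ ^ 2) P ∧
      ∫ ω, ‖xhat t ω - p.xstar‖ ^ 2 ∂P ≤ (1 - p.sagaRate) ^ t * p.initialError := by
  have hL := p.L_pos
  have hγ : 0 ≤ 1 / (5 * p.L) := by positivity
  refine ⟨(h.isFinitelyValued_xhat_sub t).norm_sq.integrable (h.past_le t), ?_⟩
  have hrate : 0 ≤ 1 - p.sagaRate := by
    have := p.min_rate_le_one
    unfold FiniteSumProblem.sagaRate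
    linarith
  have hind : distSq p (1 / (5 * p.L)) P idx xhat ahat t
      + 3 / (25 * p.L ^ 2) * memorySq p P ahat t
      ≤ (1 - p.sagaRate) ^ t * (distSq p (1 / (5 * p.L)) P idx xhat ahat 0
        + 3 / (25 * p.L ^ 2) * memorySq p P ahat 0) := by
    induction t with
    | zero => simp
    | succ t ih =>
      refine (h.sequential_step t).trans ?_
      rw [pow_succ' (1 - p.sagaRate), mul_assoc]
      exact mul_le_mul_of_nonneg_left ih hrate
  have hinit : distSq p (1 / (5 * p.L)) P idx xhat ahat 0
      + 3 / (25 * p.L ^ 2) * memorySq p P ahat 0 ≤ p.initialError := by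
    rw [h.distSq_zero, h.memorySq_zero, FiniteSumProblem.initialError]
    refine add_le_add_right (mul_le_mul_of_nonneg_right ?_ (by positivity)) _
    rw [div_le_div_iff₀ (by positivity) (by positivity)]
    nlinarith [sq_nonneg p.L]
  have hx : ∫ ω, ‖xhat t ω - p.xstar‖ ^ 2 ∂P = distSq p (1 / (5 * p.L)) P idx xhat ahat t := by
    simp only [distSq, h.xhat_eq_virtual hγ]
  have hM : 0 ≤ memorySq p P ahat t :=
    Finset.sum_nonneg fun j _ => integral_nonneg fun _ => sq_nonneg _
  have hcM : 0 ≤ 3 / (25 * p.L ^ 2) * memorySq p P ahat t := by positivity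
  have := mul_le_mul_of_nonneg_left hinit (pow_nonneg hrate t)
  rw [hx]
  linarith

end Sequential

/-! ### Asaga with the two choices of step size. -/

variable {n d : ℕ} {Ω : Type*} {p : FiniteSumProblem n d} {γ : ℝ} {τ : ℕ}
  [mΩ : MeasurableSpace Ω] {P : Measure Ω} {idx : ℕ → Ω → Fin n} {xhat : ℕ → Ω → Vec d}
  {ahat : ℕ → Ω → Fin n → Vec d} {T : ℕ → Ω → IterationTimes n d} [IsProbabilityMeasure P]

/-- Asaga with step size `a / L` matches the rate of Saga if `a` is small enough, but not too small
compared with the rate. -/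
theorem matchesSagaRate {a c : ℝ} (h : IsAsagaRun p (a / p.L) τ P idx xhat ahat T) (ha : 0 < a)
    (hc : 0 < c) (hca : 2 * (c * min (1 / (n : ℝ)) (1 / p.kappa)) ≤ a / p.kappa)
    (hτ : (2 * (τ / n) + 1) * c ≤ 1 / 10)
    (hstep : 81 * (a * (1 + τ * √p.Delta) * (1 + τ / n)) ≤ 4) :
    MatchesSagaRate p (a / p.L) P xhat c 1 := by
  have hL := p.L_pos
  have hn := p.n_cast_pos
  have hn1 := p.one_le_n_cast
  have hmin := p.min_rate_pos
  have hminn := p.min_rate_mul_n_le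
  have hγ : 0 < a / p.L := div_pos ha hL
  have hτn : (0 : ℝ) ≤ τ / n := by positivity
  have hc1 : c ≤ 1 / 10 := by nlinarith
  refine p.matchesSagaRate_of_geometric hγ hc (by linarith)
    (fun t => (h.isFinitelyValued_objective le_rfl).integrable (h.past_le t)) fun t => ?_
  refine h.geometric_gap hγ (by positivity) ?_ ?_ ?_ ?_ t
  · refine hca.trans (le_of_eq ?_)
    unfold FiniteSumProblem.kappa
    field_simp
  · have e : (2 * (τ : ℝ) + 1) ≤ (2 * (τ / n) + 1) * n := by
      have : (2 * ((τ : ℝ) / n) + 1) * n = 2 * τ + n := by field_simp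
      linarith
    calc (2 * (τ : ℝ) + 1) * (c * min (1 / (n : ℝ)) (1 / p.kappa))
        ≤ (2 * (τ / n) + 1) * n * (c * min (1 / (n : ℝ)) (1 / p.kappa)) := by gcongr
      _ = (2 * (τ / n) + 1) * c * (min (1 / (n : ℝ)) (1 / p.kappa) * n) := by ring
      _ ≤ 1 / 10 * 1 := by gcongr
      _ = 1 / 10 := by norm_num
  · calc (n : ℝ) * (c * min (1 / (n : ℝ)) (1 / p.kappa))
        = c * (min (1 / (n : ℝ)) (1 / p.kappa) * n) := by ring
      _ ≤ 1 / 10 * 1 := by gcongr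
      _ = 1 / 10 := by norm_num
  · rwa [div_mul_cancel₀ a hL.ne']

/-- For the step size condition only ξ ≥ 1 matters: a*(1 + τ√Δ) ≤ 1/32 and 81/32 · 11/10 < 4. The
size of ξ enters only through the comparison of a* with the rate. -/
theorem matchesSagaRate_aStar {C : ℝ} (hC : 0 < C) (hτn : (τ : ℝ) < n / 10)
    (hτ : (τ : ℝ) ≤ C * (1 / √p.Delta * max 1 (n / p.kappa)))
    (h : IsAsagaRun p (p.aStar τ / p.L) τ P idx xhat ahat T) :
    MatchesSagaRate p (p.aStar τ / p.L) P xhat (1 / (64 * (3 + 2 * C))) 1 := by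
  have hn := p.n_cast_pos
  have hξ := p.one_le_xi τ
  have hδ : 0 ≤ √p.Delta := Real.sqrt_nonneg _
  have hq : (τ : ℝ) / n ≤ 1 / 10 := by
    rw [div_le_iff₀ hn]; linarith
  have hq0 : (0 : ℝ) ≤ τ / n := by positivity
  have ha : 0 < p.aStar τ := by unfold FiniteSumProblem.aStar; positivity
  have hc : 1 / (64 * (3 + 2 * C)) ≤ 1 / 192 :=
    one_div_le_one_div_of_le (by norm_num) (by linarith)
  have hc0 : 0 < 1 / (64 * (3 + 2 * C)) := by positivity
  refine h.matchesSagaRate ha hc0 (p.two_mul_rate_le_aStar_div hC hτn hτ) ?_ ?_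
  · calc (2 * ((τ : ℝ) / n) + 1) * (1 / (64 * (3 + 2 * C)))
        ≤ (2 * (1 / 10) + 1) * (1 / 192) := by gcongr
      _ ≤ 1 / 10 := by norm_num
  · have h1 : p.aStar τ * (1 + τ * √p.Delta) ≤ 1 / 32 := by
      have e : p.aStar τ * (1 + τ * √p.Delta) = 1 / 32 * (1 / p.xi τ) := by
        unfold FiniteSumProblem.aStar; field_simp
      have : 1 / p.xi τ ≤ 1 := (div_le_one (by linarith)).2 hξ
      rw [e]; linarith
    calc 81 * (p.aStar τ * (1 + τ * √p.Delta) * (1 + τ / n))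
        ≤ 81 * (1 / 32 * (1 + 1 / 10)) := by gcongr
      _ ≤ 4 := by norm_num

/-- Both τ√Δ and τ/n are at most C, so a = 4/(81(1 + C)²) is the largest value that these bounds
allow in the step size condition. The two terms of c ensure 2ρ ≤ γμ and (2τ + 1)ρ ≤ 1/10,
respectively. -/
theorem matchesSagaRate_universal {C : ℝ} (hC : 0 < C) (hτ : (τ : ℝ) ≤ C * (1 / √p.Delta))
    (h : IsAsagaRun p (4 / (81 * (1 + C) ^ 2) / p.L) τ P idx xhat ahat T) :
    MatchesSagaRate p (4 / (81 * (1 + C) ^ 2) / p.L) P xhat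
      (min (2 / (81 * (1 + C) ^ 2)) (1 / (10 * (2 * C + 1)))) 1 := by
  have hκ := p.kappa_pos
  have hq := p.tau_div_n_le hC hτ
  have hn := p.n_cast_pos
  have hq0 : (0 : ℝ) ≤ τ / n := by positivity
  have hτδ : τ * √p.Delta ≤ C := p.tau_mul_sqrt_Delta_le hC.le (by linarith)
  refine h.matchesSagaRate (by positivity) (by positivity) ?_ ?_ ?_
  · calc 2 * (min (2 / (81 * (1 + C) ^ 2)) (1 / (10 * (2 * C + 1)))
          * min (1 / (n : ℝ)) (1 / p.kappa))
        ≤ 2 * (2 / (81 * (1 + C) ^ 2) * (1 / p.kappa)) := by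
          gcongr
          · exact min_le_left _ _
          · exact min_le_right _ _
      _ = 4 / (81 * (1 + C) ^ 2) / p.kappa := by ring
  · calc (2 * ((τ : ℝ) / n) + 1) * min (2 / (81 * (1 + C) ^ 2)) (1 / (10 * (2 * C + 1)))
        ≤ (2 * C + 1) * (1 / (10 * (2 * C + 1))) := by
          gcongr
          exact min_le_right _ _
      _ = 1 / 10 := by field_simp
  · calc 81 * (4 / (81 * (1 + C) ^ 2) * (1 + τ * √p.Delta) * (1 + τ / n))
        ≤ 81 * (4 / (81 * (1 + C) ^ 2) * (1 + C) * (1 + C)) := by gcongr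
      _ = 4 := by field_simp
      _ ≤ 4 := le_rfl

end IsAsagaRun

/-- Sequential Sparse Saga (no overlap) has rate factor `(1/5) min {1/n, 1/κ}`; Asaga with step size
`a*(τ)/L` matches it up to a constant factor if `τ < n/10` and `τ = O((1/√Δ) max {1, n/κ})`; and if
`τ = O(1/√Δ)`, so does Asaga with a step size `a/L` where `a` is a constant. -/
theorem corollary3 :
    (∀ (n d : ℕ) (p : FiniteSumProblem n d)
      (Ω : Type*) [MeasurableSpace Ω] (P : MeasureTheory.Measure Ω)
      [MeasureTheory.IsProbabilityMeasure P]
      (idx : ℕ → Ω → Fin n) (xhat : ℕ → Ω → Vec d) (ahat : ℕ → Ω → Fin n → Vec d)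
      (T : ℕ → Ω → IterationTimes n d),
      IsAsagaRun p (1 / (5 * p.L)) 0 P idx xhat ahat T →
      ∀ t : ℕ,
        MeasureTheory.Integrable (fun ω => ‖xhat t ω - p.xstar‖ ^ 2) P ∧
        ∫ ω, ‖xhat t ω - p.xstar‖ ^ 2 ∂P ≤ (1 - p.sagaRate) ^ t * p.initialError) ∧
    (∃ K : ℝ, 0 < K ∧
      (∀ C : ℝ, 0 < C → ∃ c : ℝ, 0 < c ∧
        ∀ (n d τ : ℕ) (p : FiniteSumProblem n d),
          (τ : ℝ) < n / 10 →
          (τ : ℝ) ≤ C * (1 / Real.sqrt p.Delta * max 1 (n / p.kappa)) →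
          ∀ (Ω : Type*) [MeasurableSpace Ω] (P : MeasureTheory.Measure Ω)
            [MeasureTheory.IsProbabilityMeasure P]
            (idx : ℕ → Ω → Fin n) (xhat : ℕ → Ω → Vec d) (ahat : ℕ → Ω → Fin n → Vec d)
            (T : ℕ → Ω → IterationTimes n d),
            IsAsagaRun p (p.aStar τ / p.L) τ P idx xhat ahat T →
            MatchesSagaRate p (p.aStar τ / p.L) P xhat c K)) ∧
    (∀ C : ℝ, 0 < C → ∃ a : ℝ, 0 < a ∧ ∃ c : ℝ, 0 < c ∧ ∃ K : ℝ, 0 < K ∧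
      ∀ (n d τ : ℕ) (p : FiniteSumProblem n d),
        (τ : ℝ) ≤ C * (1 / Real.sqrt p.Delta) →
        ∀ (Ω : Type*) [MeasurableSpace Ω] (P : MeasureTheory.Measure Ω)
          [MeasureTheory.IsProbabilityMeasure P]
          (idx : ℕ → Ω → Fin n) (xhat : ℕ → Ω → Vec d) (ahat : ℕ → Ω → Fin n → Vec d)
          (T : ℕ → Ω → IterationTimes n d),
          IsAsagaRun p (a / p.L) τ P idx xhat ahat T →
          MatchesSagaRate p (a / p.L) P xhat c K) := by
  refine ⟨?_, ⟨1, one_pos, ?_⟩, ?_⟩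
  · intro n d p Ω _ P _ idx xhat ahat T h t
    exact h.sequential_convergence t
  · intro C hC
    refine ⟨1 / (64 * (3 + 2 * C)), by positivity, ?_⟩
    intro n d τ p hτn hτ Ω _ P _ idx xhat ahat T h
    exact h.matchesSagaRate_aStar hC hτn hτ
  · intro C hC
    refine ⟨4 / (81 * (1 + C) ^ 2), by positivity,
      min (2 / (81 * (1 + C) ^ 2)) (1 / (10 * (2 * C + 1))), by positivity, 1, one_pos, ?_⟩
    intro n d τ p hτ Ω _ P _ idx xhat ahat T h
    exact h.matchesSagaRate_universal hC hτ
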